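/- **Proposition 4.12** (Gritsenko [G2], Lemma 4.5). Let $s\ge 1$ be an integer, let $L_0=\mathbb Z^s$ be a positive definite even integral lattice with Gram matrix $S_0$, let $\Pi_{1,1}$ be the rank-two lattice with Gram matrix $I=\begin{pmatrix}0&-1\\-1&0\end{pmatrix}$, and let $M=\Pi_{1,1}\oplus L_0\oplus\Pi_{1,1}$ be the even integral lattice of signature $(s+2,2)$ with Gram matrix $$S_M=\begin{pmatrix}0&0&I\\0&S_0&0\\I&0&0\end{pmatrix}.$$ Suppose that $M$ is a maximal even integral lattice, i.e. $M$ is not a proper sublattice of any even integral lattice of the same rank. Then there exists a nonconstant singular Jacobi form of index $1$ (of some weight $k\in\mathbb Z_{\ge0}$) with respect to $\Gamma_M^J$ if and only if $M$ is unimodular. Here write $S_0[v]={}^t v S_0 v$, let $H_1$ be the upper half plane, and let $$\mathcal D=\{Z=(\omega,z,\tau)\in H_1\times\mathbb C^s\times H_1 : S_0[\operatorname{Im}z]-2\operatorname{Im}\omega\operatorname{Im}\tau<0\},\qquad p(Z)={}^t\big(\tfrac12S_0[z]-\omega\tau,\ \omega,\ z,\ \tau,\ 1\big).$$ Let $G_{\mathbb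 R}$ be the group of all $g\in GL_{s+4}(\mathbb R)$ with ${}^tgS_Mg=S_M$ that preserve the image of $p(\mathcal D)$ in $\mathbb P^{s+3}(\mathbb C)$. For $g\in G_{\mathbb R}$ let $J(g,Z)$ be the last coordinate of $g\,p(Z)$ and let $g\langle Z\rangle\in\mathcal D$ be defined by $g\,p(Z)=J(g,Z)\,p(g\langle Z\rangle)$; write $\omega(g;Z)$ for the $\omega$-component of $g\langle Z\rangle$. Let $\Gamma_M$ be the subgroup of $G_{\mathbb R}$ preserving $M=\mathbb Z^{s+4}$. The Jacobi group $G^J_{\mathbb R}\subset G_{\mathbb R}$ is generated by the matrices $\operatorname{diag}(I\,{}^tA^{-1}I,E_s,A)$, $A\in SL(2,\mathbb R)$, and $$\{x,y;r\}=\begin{pmatrix}1&0&{}^tyS_0&{}^txS_0y-r&\frac12S_0[y]\\0&1&{}^txS_0&\frac12S_0[x]&r\\0&0&E_s&x&y\\0&0&0&1&0\\0&0&0&0&1\end{pmatrix},\qquad x,y\in\mathbb R^s,\ r\in\mathbb R,$$ and $\Gamma_M^J=\Gamma_M\cap G^J_{\mathbb R}$. The $(\tau,z)$-component of $g\langle(\omega,z,\tau)\rangle$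 for $g\in G^J_{\mathbb R}$ does not depend on $\omega$; it is denoted $g\langle(\tau,z)\rangle$. For integers $k,m\ge0$, a Jacobi form of weight $k$ and index $m$ with respect to $\Gamma_M^J$ is a holomorphic function $\phi:H_1\times\mathbb C^s\to\mathbb C$ such that $$J(\gamma,Z)^{-k}\,e^{2\pi im(\omega(\gamma;Z)-\omega)}\,\phi(\gamma\langle(\tau,z)\rangle)=\phi(\tau,z)\qquad\text{for all }\gamma\in\Gamma_M^J,\ Z=(\omega,z,\tau)\in\mathcal D,$$ and which has an (absolutely convergent) Fourier expansion $$\phi(\tau,z)=\sum_{n\in\mathbb Z}\ \sum_{\ell\in\widehat{L_0}}c(n,\ell)\,e^{2\pi i(n\tau+{}^t\ell S_0z)}$$ with $c(n,\ell)\ne0$ only if $2nm-S_0[\ell]\ge0$, where $\widehat{L_0}=\{\ell\in\mathbb Q^s:{}^t\ell S_0\alpha\in\mathbb Z\text{ for all }\alpha\in\mathbb Z^s\}$. It is called singular if $c(n,\ell)\neq0$ implies $2nm-S_0[\ell]=0$. -/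

import Mathlib

open scoped MatrixGroups

noncomputable section

namespace OrthJacobi

/-! ### Lattices given by Gram matrices -/

/-- The bilinear form `ᵗv S w` of an integral matrix `S`, on vectors over any commutative ring.
One writes `S[v]` for `bil S v v`. -/
def bil {ι R : Type*} [Fintype ι] [CommRing R] (S : Matrix ι ι ℤ) (v w : ι → R) : R :=
  v ⬝ᵥ (S.map (Int.cast : ℤ → R)).mulVec w

/-- `N`, a subgroup of the rational quadratic space `(ℚ^ι, S)`, is an even integral lattice:
finitely generated, with integral products `(v, w)` and even norms `(v, v)`. -/
def IsEvenIntegral {ι : Type*} [Fintype ι] (S : Matrix ι ι ℤ) (N : Submodule ℤ (ι → ℚ)) : Prop :=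
  N.FG ∧ (∀ v ∈ N, ∀ w ∈ N, ∃ a : ℤ, bil S v w = a) ∧ ∀ v ∈ N, ∃ a : ℤ, bil S v v = 2 * a

/-- The standard lattice `ℤ^ι` in `ℚ^ι`. -/
def stdLattice (ι : Type*) : Submodule ℤ (ι → ℚ) where
  carrier := {v | ∀ i, ∃ a : ℤ, v i = a}
  zero_mem' := fun _ => ⟨0, by simp⟩
  add_mem' := fun {v w} hv hw i => by
    obtain ⟨a, ha⟩ := hv i
    obtain ⟨b, hb⟩ := hw i
    exact ⟨a + b, by simp [ha, hb]⟩
  smul_mem' := fun c v hv i => by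
    obtain ⟨a, ha⟩ := hv i
    exact ⟨c * a, by simp [ha]⟩

/-- The lattice with Gram matrix `S` is a maximal even integral lattice: it is even integral and
it is not a proper sublattice of an even integral lattice of the same rank. Such an overlattice
lies in the rational space spanned by the lattice. -/
def IsMaximalEven {ι : Type*} [Fintype ι] (S : Matrix ι ι ℤ) : Prop :=
  IsEvenIntegral S (stdLattice ι) ∧
    ∀ N : Submodule ℤ (ι → ℚ), IsEvenIntegral S N → stdLattice ι ≤ N → N = stdLattice ι

/-- The lattice with Gram matrix `S` is unimodular. -/
def IsUnimodular {ι : Type*} [Fintype ι] [DecidableEq ι] (S : Matrix ι ι ℤ) : Prop :=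
  IsUnit S.det

/-- The dual lattice `{ℓ ∈ ℚ^ι | ᵗℓ S α ∈ ℤ for all α ∈ ℤ^ι}`. -/
def dualLattice {ι : Type*} [Fintype ι] (S : Matrix ι ι ℤ) : Set (ι → ℚ) :=
  {l | ∀ α : ι → ℤ, ∃ a : ℤ, bil S l (fun i => (α i : ℚ)) = a}

/-- Coordinates of `M = ℤe₁ ⊕ ℤe₂ ⊕ L₀ ⊕ ℤe₋₂ ⊕ ℤe₋₁`. -/
abbrev Idx (s : ℕ) : Type := Fin 2 ⊕ (Fin s ⊕ Fin 2)

variable {s : ℕ}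

/-- The Gram matrix of the hyperbolic plane `Π_{1,1}`. -/
def hyp (R : Type*) [CommRing R] : Matrix (Fin 2) (Fin 2) R := !![0, -1; -1, 0]

/-- The block matrix with diagonal blocks `A`, `U`, `D`, blocks `B`, `Y` to the right of `A` and
block `X` to the right of `U`, and zeros below the diagonal. -/
def upper {R : Type*} [CommRing R] (A : Matrix (Fin 2) (Fin 2) R) (B : Matrix (Fin 2) (Fin s) R)
    (Y : Matrix (Fin 2) (Fin 2) R) (U : Matrix (Fin s) (Fin s) R) (X : Matrix (Fin s) (Fin 2) R)
    (D : Matrix (Fin 2) (Fin 2) R) : Matrix (Idx s) (Idx s) R :=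
  Matrix.fromBlocks A (Matrix.fromCols B Y) 0 (Matrix.fromBlocks U X 0 D)

/-- The Gram matrix `S_M` of `M = Π_{1,1} ⊕ L₀ ⊕ Π_{1,1}`, where `S₀` is that of `L₀`. -/
def gramM (S₀ : Matrix (Fin s) (Fin s) ℤ) : Matrix (Idx s) (Idx s) ℤ :=
  Matrix.fromBlocks 0 (Matrix.fromCols 0 (hyp ℤ)) (Matrix.fromRows 0 (hyp ℤ))
    (Matrix.fromBlocks S₀ 0 0 0)

/-! ### The tube domain and the action of the orthogonal group -/

/-- A point `(ω, z, τ)` of `ℂ^{s+2}`. -/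
structure Pt (s : ℕ) where
  ω : ℂ
  z : Fin s → ℂ
  τ : ℂ

/-- The tube domain `{(ω, z, τ) | ω, τ ∈ H₁, S₁[Im Z] < 0}`; here
`S₁[(a, v, b)] = S₀[v] - 2 a b`. -/
def tube (S₀ : Matrix (Fin s) (Fin s) ℤ) : Set (Pt s) :=
  {Z | 0 < Z.ω.im ∧ 0 < Z.τ.im ∧
    bil S₀ (fun i => (Z.z i).im) (fun i => (Z.z i).im) - 2 * Z.ω.im * Z.τ.im < 0}

/-- The Borel embedding `p(Z) = (½ S₁[Z] : ω : z : τ : 1)`, in homogeneous coordinates. -/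
def borelEmb (S₀ : Matrix (Fin s) (Fin s) ℤ) (Z : Pt s) : Idx s → ℂ :=
  Sum.elim ![(bil S₀ Z.z Z.z - 2 * Z.ω * Z.τ) / 2, Z.ω] (Sum.elim Z.z ![Z.τ, 1])

/-- The vector `g · p(Z)`. -/
def actBorel (S₀ : Matrix (Fin s) (Fin s) ℤ) (g : Matrix (Idx s) (Idx s) ℝ) (Z : Pt s) :
    Idx s → ℂ :=
  (g.map (Complex.ofReal : ℝ → ℂ)).mulVec (borelEmb S₀ Z)

/-- The automorphic factor `J(g, Z)`: the last coordinate of `g · p(Z)`. -/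
def J (S₀ : Matrix (Fin s) (Fin s) ℤ) (g : Matrix (Idx s) (Idx s) ℝ) (Z : Pt s) : ℂ :=
  actBorel S₀ g Z (Sum.inr (Sum.inr 1))

/-- The action `g⟨Z⟩`, so that `J(g, Z) p(g⟨Z⟩) = g · p(Z)`. -/
def act (S₀ : Matrix (Fin s) (Fin s) ℤ) (g : Matrix (Idx s) (Idx s) ℝ) (Z : Pt s) : Pt s where
  ω := actBorel S₀ g Z (Sum.inl 1) / J S₀ g Z
  z := fun i => actBorel S₀ g Z (Sum.inr (Sum.inl i)) / J S₀ g Z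
  τ := actBorel S₀ g Z (Sum.inr (Sum.inr 0)) / J S₀ g Z

/-- The cone in `M_ℂ` over the domain `D⁺ ⊂ ℙ(M_ℂ)`, the image of the Borel embedding. -/
def coneD (S₀ : Matrix (Fin s) (Fin s) ℤ) : Set (Idx s → ℂ) :=
  {v | ∃ Z ∈ tube S₀, ∃ t : ℂ, t ≠ 0 ∧ v = t • borelEmb S₀ Z}

/-- `G_ℝ`: the elements of the real orthogonal group of `S_M` that preserve `D⁺`. -/
def GR (S₀ : Matrix (Fin s) (Fin s) ℤ) : Set (GL (Idx s) ℝ) :=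
  {g | (g : Matrix (Idx s) (Idx s) ℝ).transpose * (gramM S₀).map (Int.cast : ℤ → ℝ) *
        (g : Matrix (Idx s) (Idx s) ℝ) = (gramM S₀).map (Int.cast : ℤ → ℝ) ∧
    ∀ v : Idx s → ℂ,
      ((g : Matrix (Idx s) (Idx s) ℝ).map (Complex.ofReal : ℝ → ℂ)).mulVec v ∈ coneD S₀ ↔
        v ∈ coneD S₀}

/-- `Γ_M`: the elements of `G_ℝ` that are isometries of the lattice `M`. An integral matrix
preserving the nondegenerate form `S_M` has determinant `±1`, so it is an automorphism of `M`. -/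
def ΓM (S₀ : Matrix (Fin s) (Fin s) ℤ) : Set (GL (Idx s) ℝ) :=
  {g | g ∈ GR S₀ ∧ ∀ i j, ∃ a : ℤ, (g : Matrix (Idx s) (Idx s) ℝ) i j = a}

/-! ### The Jacobi group -/

/-- `{A} = diag(A⁰, E_s, A)` with `A⁰ = I ᵗA⁻¹ I`. -/
def levi (s : ℕ) (A : SL(2, ℝ)) : Matrix (Idx s) (Idx s) ℝ :=
  upper (hyp ℝ * ((A⁻¹ : SL(2, ℝ)) : Matrix (Fin 2) (Fin 2) ℝ).transpose * hyp ℝ) 0 0 1 0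
    (A : Matrix (Fin 2) (Fin 2) ℝ)

/-- The element `{x, y; r}` of the Heisenberg group. -/
def heis (S₀ : Matrix (Fin s) (Fin s) ℤ) (x y : Fin s → ℝ) (r : ℝ) :
    Matrix (Idx s) (Idx s) ℝ :=
  upper 1
    (Matrix.of ![Matrix.vecMul y (S₀.map (Int.cast : ℤ → ℝ)),
      Matrix.vecMul x (S₀.map (Int.cast : ℤ → ℝ))])
    !![bil S₀ x y - r, bil S₀ y y / 2; bil S₀ x x / 2, r]
    1 (Matrix.of fun i => ![x i, y i]) 1

/-- The real Jacobi group `G^J_ℝ`, generated by all `{A}` and all `{x, y; r}`. -/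
def GJ (S₀ : Matrix (Fin s) (Fin s) ℤ) : Subgroup (GL (Idx s) ℝ) :=
  Subgroup.closure
    {g | (∃ A : SL(2, ℝ), (g : Matrix (Idx s) (Idx s) ℝ) = levi s A) ∨
      ∃ (x y : Fin s → ℝ) (r : ℝ), (g : Matrix (Idx s) (Idx s) ℝ) = heis S₀ x y r}

/-- `Γ^J_M = Γ_M ∩ G^J_ℝ`. -/
def ΓJ (S₀ : Matrix (Fin s) (Fin s) ℤ) : Set (GL (Idx s) ℝ) :=
  ΓM S₀ ∩ (GJ S₀ : Set (GL (Idx s) ℝ))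

/-! ### Jacobi forms -/

/-- `H₁ × ℂ^s`. -/
def dom (s : ℕ) : Set (ℂ × (Fin s → ℂ)) := {p | 0 < p.1.im}

/-- The automorphic factor `J(g, Z)^k e^{-2πi m ω(g; Z)} e^{2πi m ω}` for the Jacobi group. For
`g ∈ G^J_ℝ` it depends only on the components `(τ, z)` of `Z ∈ tube S₀`. -/
def Jkm (S₀ : Matrix (Fin s) (Fin s) ℤ) (k m : ℕ) (g : Matrix (Idx s) (Idx s) ℝ) (Z : Pt s) : ℂ :=
  J S₀ g Z ^ k * Complex.exp (-(2 * Real.pi * Complex.I * m * (act S₀ g Z).ω)) *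
    Complex.exp (2 * Real.pi * Complex.I * m * Z.ω)

/-- `(φ|_{k,m} g)(τ, z)`, computed at a point `Z = (ω, z, τ)` of the tube domain. -/
def slash (S₀ : Matrix (Fin s) (Fin s) ℤ) (k m : ℕ) (φ : ℂ × (Fin s → ℂ) → ℂ)
    (g : Matrix (Idx s) (Idx s) ℝ) (Z : Pt s) : ℂ :=
  (Jkm S₀ k m g Z)⁻¹ * φ ((act S₀ g Z).τ, (act S₀ g Z).z)

/-- `φ` has the (absolutely convergent) Fourier expansion
`φ(τ, z) = ∑_{n ∈ ℤ} ∑_{ℓ ∈ dual of L₀} c(n, ℓ) e^{2πi(nτ + ᵗℓ S₀ z)}` on `H₁ × ℂ^s`. -/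
def HasFourier (S₀ : Matrix (Fin s) (Fin s) ℤ) (φ : ℂ × (Fin s → ℂ) → ℂ)
    (c : ℤ → dualLattice S₀ → ℂ) : Prop :=
  ∀ p ∈ dom s, HasSum
    (fun q : ℤ × dualLattice S₀ => c q.1 q.2 *
      Complex.exp (2 * Real.pi * Complex.I *
        (q.1 * p.1 + bil S₀ (fun i => ((q.2 : Fin s → ℚ) i : ℂ)) p.2)))
    (φ p)

/-- `φ` (considered on `H₁ × ℂ^s` only) is a Jacobi form of weight `k` and index `m` on `Γ^J_M`. -/
def IsJacobiForm (S₀ : Matrix (Fin s) (Fin s) ℤ) (k m : ℕ) (φ : ℂ × (Fin s → ℂ) → ℂ) : Prop :=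
  DifferentiableOn ℂ φ (dom s) ∧
  (∀ γ ∈ ΓJ S₀, ∀ Z ∈ tube S₀, slash S₀ k m φ (γ : Matrix (Idx s) (Idx s) ℝ) Z = φ (Z.τ, Z.z)) ∧
  ∃ c : ℤ → dualLattice S₀ → ℂ, HasFourier S₀ φ c ∧
    ∀ n l, c n l ≠ 0 → 0 ≤ 2 * (n : ℚ) * m - bil S₀ (l : Fin s → ℚ) (l : Fin s → ℚ)

/-- `φ` is a singular Jacobi form of weight `k` and index `m`: its Fourier coefficients (which are
unique) satisfy `2nm - S₀[ℓ] = 0` whenever `c(n, ℓ) ≠ 0`. -/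
def IsSingularJacobiForm (S₀ : Matrix (Fin s) (Fin s) ℤ) (k m : ℕ)
    (φ : ℂ × (Fin s → ℂ) → ℂ) : Prop :=
  IsJacobiForm S₀ k m φ ∧
  ∃ c : ℤ → dualLattice S₀ → ℂ, HasFourier S₀ φ c ∧
    ∀ n l, c n l ≠ 0 → 2 * (n : ℚ) * m - bil S₀ (l : Fin s → ℚ) (l : Fin s → ℚ) = 0

end OrthJacobi

end

noncomputable section

namespace OrthJacobi

variable {s : ℕ}

/-! ### Calculus of the bilinear form of an integral matrix. -/

section bil

variable {ι R : Type*} [Fintype ι] [CommRing R] (S : Matrix ι ι ℤ)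

/-! A singular form of index 1 is supported on pairs (n, ℓ) with S₀[ℓ] = 2n, so on dual vectors ℓ of
even norm. Adjoining such an ℓ to M gives an even integral overlattice, so maximality puts ℓ in L₀
(`integral_of_mem_dual`). Hence φ(τ, z + μ) = φ(τ, z) for every μ in the dual of L₀, not only for μ
in L₀. The inversion τ ↦ -1/τ turns this into a quasi-periodicity under z ↦ z + τμ. Translation by ν
and by τμ commute, but the exponential factors commute only up to exp(2πi ᵗμS₀ν). At a point where φ
does not vanish this number is therefore 1, and the dual lattice has integral products
(`IsSingularJacobiForm.exists_int_bil`). The entries of S₀⁻¹ are such products, so S₀, and with it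
M, is unimodular.

Conversely, if M is unimodular, so is L₀, and an even unimodular lattice has even rank s = 2k. Its
theta function `theta` is a singular Jacobi form of weight k. Termwise estimates give holomorphy,
and its Fourier expansion is its definition. Poisson summation on ℤ^s and self-duality give the
inversion formula with factor (-iτ)^k (`theta_neg_inv`), and the order three element τ ↦ -1/(τ + 1)
forces (-i)^k = 1 (`neg_I_pow_eq_one`). Every element of the integral Jacobi group is an element of
SL(2, ℤ) times an integral Heisenberg element (`exists_int_levi_mul_heis`), so invariance needs
checking only for the two generators of SL(2, ℤ) and for lattice translations. -/

lemma bil_eq_sum (v w : ι → R) : bil S v w = ∑ i, ∑ j, v i * S i j * w j := by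
  simp only [bil, dotProduct, Matrix.mulVec, Matrix.map_apply, Finset.mul_sum, mul_assoc]

lemma bil_add_left (u v w : ι → R) : bil S (u + v) w = bil S u w + bil S v w := by
  simp [bil, add_dotProduct]

lemma bil_add_right (u v w : ι → R) : bil S u (v + w) = bil S u v + bil S u w := by
  simp [bil, Matrix.mulVec_add, dotProduct_add]

lemma bil_smul_left (c : R) (v w : ι → R) : bil S (c • v) w = c * bil S v w := by
  simp [bil]

lemma bil_smul_right (c : R) (v w : ι → R) : bil S v (c • w) = c * bil S v w := by
  simp [bil, Matrix.mulVec_smul]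

lemma bil_zero_left (w : ι → R) : bil S 0 w = 0 := by simp [bil]

lemma bil_zero_right (w : ι → R) : bil S w 0 = 0 := by simp [bil]

lemma bil_neg_left (v w : ι → R) : bil S (-v) w = -bil S v w := by
  simp [bil]

lemma bil_neg_right (v w : ι → R) : bil S v (-w) = -bil S v w := by
  simp [bil, Matrix.mulVec_neg]

variable {S}

lemma bil_comm (hS : S.transpose = S) (v w : ι → R) : bil S v w = bil S w v := by
  rw [bil_eq_sum, bil_eq_sum, Finset.sum_comm]
  refine Finset.sum_congr rfl fun i _ => Finset.sum_congr rfl fun j _ => ?_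
  have : S j i = S i j := congrFun (congrFun hS i) j
  rw [this]; ring

variable (S)

lemma map_bil {R' : Type*} [CommRing R'] (f : R →+* R') (v w : ι → R) :
    f (bil S v w) = bil S (fun i => f (v i)) (fun i => f (w i)) := by
  simp [bil_eq_sum]

lemma bil_intCast (v w : ι → ℤ) :
    bil S (fun i => (v i : R)) (fun i => (w i : R)) = ((bil S v w : ℤ) : R) :=
  (map_bil S (Int.castRingHom R) v w).symm

lemma bil_ofReal (v w : ι → ℝ) :
    bil S (fun i => (v i : ℂ)) (fun i => (w i : ℂ)) = ((bil S v w : ℝ) : ℂ) :=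
  (map_bil S Complex.ofRealHom v w).symm

lemma bil_ratCast (v w : ι → ℚ) :
    bil S (fun i => (v i : ℂ)) (fun i => (w i : ℂ)) = ((bil S v w : ℚ) : ℂ) :=
  (map_bil S (Rat.castHom ℂ) v w).symm

lemma bil_single_single [DecidableEq ι] (i j : ι) :
    bil S (Pi.single i (1 : R)) (Pi.single j 1) = S i j := by
  simp [bil]

end bil

/-! ### The Gram form of M: maximality, unimodularity and the parity of the rank. -/

lemma transpose_eq_of_posDef {S₀ : Matrix (Fin s) (Fin s) ℤ}
    (hpos : (S₀.map (Int.cast : ℤ → ℝ)).PosDef) : S₀.transpose = S₀ := by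
  ext i j
  have h := congrFun (congrFun hpos.1 i) j
  simp only [Matrix.conjTranspose_apply, Matrix.map_apply, star_trivial] at h
  exact_mod_cast h

/-- The Gram form of `M` in coordinates. -/
lemma bil_gramM {R : Type*} [CommRing R] (S₀ : Matrix (Fin s) (Fin s) ℤ) (v w : Idx s → R) :
    bil (gramM S₀) v w =
      bil S₀ (fun i => v (.inr (.inl i))) (fun i => w (.inr (.inl i))) -
        v (.inl 0) * w (.inr (.inr 1)) - v (.inl 1) * w (.inr (.inr 0)) -
        v (.inr (.inr 0)) * w (.inl 1) - v (.inr (.inr 1)) * w (.inl 0) := by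
  simp [bil_eq_sum, gramM, hyp, Fin.sum_univ_two, Fintype.sum_sum_type, Matrix.fromBlocks,
    Matrix.fromCols, Matrix.fromRows_apply_inl, Matrix.fromRows_apply_inr]
  ring

/-- The vector `(0, v, 0)` of `M ⊗ R`. -/
def midVec {R : Type*} [Zero R] (v : Fin s → R) : Idx s → R := Sum.elim 0 (Sum.elim v 0)

lemma bil_gramM_midVec_left {R : Type*} [CommRing R] (S₀ : Matrix (Fin s) (Fin s) ℤ)
    (v : Fin s → R) (w : Idx s → R) :
    bil (gramM S₀) (midVec v) w = bil S₀ v (fun i => w (.inr (.inl i))) := by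
  simp [bil_gramM, midVec]

lemma even_bil_self {S₀ : Matrix (Fin s) (Fin s) ℤ} (hmax : IsMaximalEven (gramM S₀))
    (n : Fin s → ℤ) : ∃ a : ℤ, bil S₀ n n = 2 * a := by
  obtain ⟨a, ha⟩ := hmax.1.2.2 (midVec fun i => (n i : ℚ)) (by
    rintro (i | i | i)
    · exact ⟨0, by simp [midVec]⟩
    · exact ⟨n i, by simp [midVec]⟩
    · exact ⟨0, by simp [midVec]⟩)
  refine ⟨a, ?_⟩
  rw [bil_gramM_midVec_left] at ha
  have := ha
  simp only [midVec, Sum.elim_inr, Sum.elim_inl, bil_intCast] at this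
  exact_mod_cast this

/-- In a maximal lattice, dual vectors of even norm are integral. -/
lemma integral_of_mem_dual {S₀ : Matrix (Fin s) (Fin s) ℤ} (hS : S₀.transpose = S₀)
    (hmax : IsMaximalEven (gramM S₀)) {l : Fin s → ℚ} (hl : l ∈ dualLattice S₀)
    (hn : ∃ a : ℤ, bil S₀ l l = 2 * a) (i : Fin s) : ∃ a : ℤ, l i = a := by
  obtain ⟨n, hn⟩ := hn
  have hdual : ∀ v ∈ stdLattice (Idx s), ∃ a : ℤ, bil (gramM S₀) (midVec l) v = a := by
    intro v hv
    choose a ha using hv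
    obtain ⟨b, hb⟩ := hl fun i => a (.inr (.inl i))
    refine ⟨b, ?_⟩
    rw [bil_gramM_midVec_left, ← hb]
    simp only [ha]
  have hT : (gramM S₀).transpose = gramM S₀ := by
    simp only [gramM, Matrix.fromBlocks_transpose, Matrix.transpose_fromCols,
      Matrix.transpose_fromRows, hS, hyp]
    congr <;> simp <;> ext i j <;> fin_cases i <;> fin_cases j <;> rfl
  have hll : bil (gramM S₀) (midVec l) (midVec l) = 2 * n := by
    rw [bil_gramM_midVec_left, ← hn]; rfl
  -- M + ℤ(0, ℓ, 0) is even integral: mixed products are integers by duality, and the new generator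
  -- has even norm. Maximality makes it equal to M.
  have key := hmax.2 (stdLattice (Idx s) ⊔ Submodule.span ℤ {midVec l}) ⟨?_, ?_, ?_⟩ le_sup_left
  · have hmem : midVec l ∈ stdLattice (Idx s) := by
      rw [← key]
      exact Submodule.mem_sup_right (Submodule.mem_span_singleton_self _)
    simpa [midVec] using hmem (.inr (.inl i))
  · exact hmax.1.1.sup (Submodule.fg_span_singleton _)
  · intro v hv w hw
    obtain ⟨v₁, hv₁, v₂, hv₂, rfl⟩ := Submodule.mem_sup.1 hv
    obtain ⟨w₁, hw₁, w₂, hw₂, rfl⟩ := Submodule.mem_sup.1 hw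
    obtain ⟨a, rfl⟩ := Submodule.mem_span_singleton.1 hv₂
    obtain ⟨b, rfl⟩ := Submodule.mem_span_singleton.1 hw₂
    obtain ⟨c₁, h₁⟩ := hmax.1.2.1 v₁ hv₁ w₁ hw₁
    obtain ⟨c₂, h₂⟩ := hdual w₁ hw₁
    obtain ⟨c₃, h₃⟩ := hdual v₁ hv₁
    refine ⟨c₁ + b * c₃ + a * c₂ + a * b * (2 * n), ?_⟩
    rw [← Int.cast_smul_eq_zsmul ℚ a, ← Int.cast_smul_eq_zsmul ℚ b]
    simp only [bil_add_left, bil_add_right, bil_smul_left, bil_smul_right, h₁, h₂, hll]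
    rw [bil_comm hT v₁, h₃]
    push_cast
    ring
  · intro v hv
    obtain ⟨v₁, hv₁, v₂, hv₂, rfl⟩ := Submodule.mem_sup.1 hv
    obtain ⟨a, rfl⟩ := Submodule.mem_span_singleton.1 hv₂
    obtain ⟨c₁, h₁⟩ := hmax.1.2.2 v₁ hv₁
    obtain ⟨c₃, h₃⟩ := hdual v₁ hv₁
    refine ⟨c₁ + a * c₃ + a * a * n, ?_⟩
    rw [← Int.cast_smul_eq_zsmul ℚ a]
    simp only [bil_add_left, bil_add_right, bil_smul_left, bil_smul_right, h₁, hll]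
    rw [bil_comm hT v₁, h₃]
    push_cast
    ring

lemma hyp_mul_hyp (R : Type*) [CommRing R] : hyp R * hyp R = 1 := by
  ext i j
  fin_cases i <;> fin_cases j <;> simp [hyp]

/-- The hyperbolic block is its own inverse, so the Gram matrix built from T inverts the one built
from S₀. -/
lemma isUnimodular_gramM_of_mul_eq_one {S₀ T : Matrix (Fin s) (Fin s) ℤ} (h : S₀ * T = 1) :
    IsUnimodular (gramM S₀) := by
  have key : gramM S₀ * gramM T = 1 := by
    simp only [gramM, Matrix.fromBlocks_multiply]
    simp only [Matrix.mul_zero, Matrix.fromCols_mul_fromRows, hyp_mul_hyp, zero_add,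
      Matrix.fromCols_mul_fromBlocks, Matrix.zero_mul, add_zero, Matrix.fromCols_zero,
      Matrix.fromBlocks_mul_fromRows, Matrix.fromRows_zero, h, Matrix.fromRows_mul,
      Matrix.mul_fromCols]
    rw [← Matrix.fromBlocks_one]
    congr 1
    ext (i | i) (j | j) <;> simp [Matrix.one_apply]
  rw [IsUnimodular, ← Matrix.isUnit_iff_isUnit_det]
  exact IsUnit.of_mul_eq_one _ key

/-- The middle rows of S_M vanish outside S₀, so the middle block of an inverse of S_M inverts S₀.
-/
lemma isUnit_of_isUnimodular_gramM {S₀ : Matrix (Fin s) (Fin s) ℤ}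
    (h : IsUnimodular (gramM S₀)) : IsUnit S₀ := by
  rw [IsUnimodular, ← Matrix.isUnit_iff_isUnit_det] at h
  obtain ⟨N, hN⟩ := h.exists_right_inv
  refine IsUnit.of_mul_eq_one (Matrix.of fun i j => N (.inr (.inl i)) (.inr (.inl j))) ?_
  ext i j
  have := congrFun (congrFun hN (.inr (.inl i))) (.inr (.inl j))
  simpa [Matrix.mul_apply, gramM, Fintype.sum_sum_type, Matrix.fromBlocks, Matrix.fromCols,
    Matrix.fromRows_apply_inl, Matrix.one_apply] using this

/-- An even symmetric matrix of odd size has even determinant. -/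
lemma even_of_isUnit {S₀ : Matrix (Fin s) (Fin s) ℤ} (hS : S₀.transpose = S₀)
    (heven : ∀ i, Even (S₀ i i)) (hu : IsUnit S₀) : Even s := by
  by_contra hodd
  rw [Nat.not_even_iff_odd] at hodd
  -- With even diagonal, S₀ agrees modulo 2 with the skew matrix U - ᵗU, whose determinant vanishes
  -- over ℤ in odd size.
  set U : Matrix (Fin s) (Fin s) ℤ := Matrix.of fun i j => if i < j then S₀ i j else 0 with hU
  have hskew : (U - U.transpose).det = 0 := by
    have h1 : (U - U.transpose).transpose = -(U - U.transpose) := by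
      simp [Matrix.transpose_sub]
    have h2 := congrArg Matrix.det h1
    rw [Matrix.det_transpose, Matrix.det_neg, Fintype.card_fin, hodd.neg_one_pow] at h2
    linarith
  have hmod : S₀.map (Int.castRingHom (ZMod 2)) =
      (U - U.transpose).map (Int.castRingHom (ZMod 2)) := by
    ext i j
    have hij : S₀ j i = S₀ i j := congrFun (congrFun hS i) j
    rcases lt_trichotomy i j with h | rfl | h
    · simp [hU, h, h.not_gt]
    · obtain ⟨a, ha⟩ := heven i
      simp [hU, ha, CharTwo.add_self_eq_zero]
    · simp [hU, h, h.not_gt, hij, CharTwo.neg_eq]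
  have h0 : (Int.castRingHom (ZMod 2)) S₀.det = 0 := by
    rw [RingHom.map_det, RingHom.mapMatrix_apply, hmod, ← RingHom.mapMatrix_apply,
      ← RingHom.map_det, hskew, map_zero]
  have := ((Matrix.isUnit_iff_isUnit_det _).1 hu).map (Int.castRingHom (ZMod 2))
  rw [h0] at this
  exact not_isUnit_zero this

/-! ### Gaussian sums over `ℤ^s` -/

/-- A finite set lies in the box spanned by its projections, and the sum over a box factors. -/
lemma summable_pi_prod {f : ℤ → ℝ} (hf : Summable f) (h0 : ∀ k, 0 ≤ f k) :
    Summable fun n : Fin s → ℤ => ∏ i, f (n i) := by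
  classical
  refine summable_of_sum_le (c := ∏ _i : Fin s, ∑' k, f k)
    (fun n => Finset.prod_nonneg fun i _ => h0 _) fun t => ?_
  calc ∑ n ∈ t, ∏ i, f (n i)
      ≤ ∑ n ∈ Fintype.piFinset fun i => t.image fun n => n i, ∏ i, f (n i) := by
        refine Finset.sum_le_sum_of_subset_of_nonneg (fun n hn => ?_)
          fun n _ _ => Finset.prod_nonneg fun i _ => h0 _
        exact Fintype.mem_piFinset.2 fun i => Finset.mem_image_of_mem _ hn
    _ = ∏ i, ∑ k ∈ t.image fun n => n i, f k := (Finset.prod_univ_sum _ _).symm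
    _ ≤ ∏ _i : Fin s, ∑' k, f k :=
        Finset.prod_le_prod (fun i _ => Finset.sum_nonneg fun k _ => h0 k)
          fun i _ => hf.sum_le_tsum _ fun k _ => h0 k

/-- One of exp(bk), exp(-bk) equals exp(b|k|), so their sum dominates it. Without the absolute value
this is the norm series of a one-variable theta function. -/
lemma summable_exp_neg_sq_add_abs {a : ℝ} (ha : 0 < a) (b : ℝ) :
    Summable fun k : ℤ => Real.exp (-a * (k : ℝ) ^ 2 + b * |(k : ℝ)|) := by
  have key : ∀ b : ℝ, Summable fun k : ℤ => Real.exp (-a * (k : ℝ) ^ 2 + b * (k : ℝ)) := by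
    intro b
    have h := ((summable_jacobiTheta₂_term_iff (((-(b / (2 * Real.pi)) : ℝ) : ℂ) * Complex.I)
      (((a / Real.pi : ℝ) : ℂ) * Complex.I)).2
      (by rw [Complex.im_ofReal_mul, Complex.I_im]; positivity)).norm
    refine h.congr fun k => ?_
    rw [norm_jacobiTheta₂_term]
    congr 1
    have := Real.pi_ne_zero
    rw [Complex.im_ofReal_mul, Complex.im_ofReal_mul, Complex.I_im]
    field_simp
    ring
  refine Summable.of_nonneg_of_le (fun k => (Real.exp_pos _).le) (fun k => ?_)
    ((key b).add (key (-b)))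
  rcases abs_choice (k : ℝ) with h | h <;> rw [h]
  · exact le_add_of_nonneg_right (Real.exp_pos _).le
  · rw [mul_neg, ← neg_mul]
    exact le_add_of_nonneg_left (Real.exp_pos _).le

lemma summable_exp_neg_sum {a : ℝ} (ha : 0 < a) (b : ℝ) :
    Summable fun n : Fin s → ℤ =>
      Real.exp (-a * ∑ i, (n i : ℝ) ^ 2 + b * ∑ i, |(n i : ℝ)|) := by
  refine (summable_pi_prod (summable_exp_neg_sq_add_abs ha b)
    fun k => (Real.exp_pos _).le).congr fun n => ?_
  rw [← Real.exp_sum, Finset.sum_add_distrib, Finset.mul_sum, Finset.mul_sum]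

/-! ### Positive definite forms -/

-- The linear change of variables x ↦ Bx turns S₀[x] into a sum of squares. It serves both the lower
-- bound below and the Gaussian integral.
open scoped MatrixOrder Matrix.Norms.L2Operator in
lemma exists_transpose_mul_self {S₀ : Matrix (Fin s) (Fin s) ℤ}
    (hpos : (S₀.map (Int.cast : ℤ → ℝ)).PosDef) :
    ∃ B : Matrix (Fin s) (Fin s) ℝ, B.transpose * B = S₀.map (Int.cast : ℤ → ℝ) := by
  obtain ⟨B, hB⟩ := CStarAlgebra.nonneg_iff_eq_star_mul_self.1 hpos.posSemidef.nonneg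
  exact ⟨B, by rw [hB, Matrix.star_eq_conjTranspose, Matrix.conjTranspose_eq_transpose_of_trivial]⟩

lemma bil_eq_sum_sq {S₀ : Matrix (Fin s) (Fin s) ℤ} {B : Matrix (Fin s) (Fin s) ℝ}
    (hB : B.transpose * B = S₀.map (Int.cast : ℤ → ℝ)) (x : Fin s → ℝ) :
    bil S₀ x x = ∑ i, (B.mulVec x i) ^ 2 := by
  rw [bil, ← hB, ← Matrix.mulVec_mulVec, Matrix.dotProduct_mulVec, Matrix.vecMul_transpose]
  simp [dotProduct, sq]

/-- Cauchy–Schwarz applied to x = B⁻¹(Bx) bounds |x|² by K|Bx|², with K the sum of squares of the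
entries of B⁻¹. Using K + 1 avoids a case K = 0. -/
lemma exists_mul_sum_sq_le_bil {S₀ : Matrix (Fin s) (Fin s) ℤ}
    (hpos : (S₀.map (Int.cast : ℤ → ℝ)).PosDef) :
    ∃ c > 0, ∀ x : Fin s → ℝ, c * ∑ i, x i ^ 2 ≤ bil S₀ x x := by
  obtain ⟨B, hB⟩ := exists_transpose_mul_self hpos
  have hdet : IsUnit B.det := by
    have h := congrArg Matrix.det hB
    rw [Matrix.det_mul, Matrix.det_transpose] at h
    rw [isUnit_iff_ne_zero]
    rintro h0
    rw [h0, mul_zero] at h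
    exact hpos.det_pos.ne h
  set K : ℝ := ∑ i, ∑ j, (B⁻¹ i j) ^ 2 with hK
  have hK0 : 0 ≤ K := by positivity
  refine ⟨(K + 1)⁻¹, by positivity, fun x => ?_⟩
  rw [inv_mul_le_iff₀ (by positivity), bil_eq_sum_sq hB]
  set y := B.mulVec x with hy
  have hx : x = B⁻¹.mulVec y := by
    rw [hy, Matrix.mulVec_mulVec, Matrix.nonsing_inv_mul _ hdet, Matrix.one_mulVec]
  have h1 : ∑ i, x i ^ 2 ≤ K * ∑ j, y j ^ 2 := by
    rw [hK, Finset.sum_mul]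
    refine Finset.sum_le_sum fun i _ => ?_
    rw [hx]
    exact Finset.sum_mul_sq_le_sq_mul_sq Finset.univ (B⁻¹ i) y
  have h2 : 0 ≤ ∑ j, y j ^ 2 := by positivity
  linarith

lemma bil_self_nonneg {S₀ : Matrix (Fin s) (Fin s) ℤ}
    (hpos : (S₀.map (Int.cast : ℤ → ℝ)).PosDef) (x : Fin s → ℝ) : 0 ≤ bil S₀ x x := by
  obtain ⟨c, hc, h⟩ := exists_mul_sum_sq_le_bil hpos
  exact le_trans (by positivity) (h x)

/-! ### The theta function -/

/-- The linear form `2πi (½ S₀[x] τ + ᵗx S₀ z)` of `(τ, z)`. -/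
def thetaArg (S₀ : Matrix (Fin s) (Fin s) ℤ) (x : Fin s → ℝ) : ℂ × (Fin s → ℂ) →L[ℂ] ℂ :=
  (2 * Real.pi * Complex.I) • ((((bil S₀ x x : ℝ) : ℂ) / 2) •
      ContinuousLinearMap.fst ℂ ℂ (Fin s → ℂ) +
    ∑ i, ∑ j, ((x i : ℂ) * S₀ i j) •
      (ContinuousLinearMap.proj (R := ℂ) (φ := fun _ : Fin s => ℂ) j).comp
        (ContinuousLinearMap.snd ℂ ℂ (Fin s → ℂ)))

lemma thetaArg_apply (S₀ : Matrix (Fin s) (Fin s) ℤ) (x : Fin s → ℝ) (p : ℂ × (Fin s → ℂ)) :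
    thetaArg S₀ x p = 2 * Real.pi * Complex.I *
      (((bil S₀ x x : ℝ) : ℂ) / 2 * p.1 + bil S₀ (fun i => (x i : ℂ)) p.2) := by
  simp [thetaArg, bil_eq_sum, mul_add]

/-- The theta function `∑_{n ∈ ℤ^s} e^{2πi (½ S₀[n] τ + ᵗn S₀ z)}`. -/
def theta (S₀ : Matrix (Fin s) (Fin s) ℤ) (p : ℂ × (Fin s → ℂ)) : ℂ :=
  ∑' n : Fin s → ℤ, Complex.exp (thetaArg S₀ (fun i => (n i : ℝ)) p)

lemma norm_bil_le (S₀ : Matrix (Fin s) (Fin s) ℤ) (x : Fin s → ℝ) (z : Fin s → ℂ) :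
    ‖bil S₀ (fun i => (x i : ℂ)) z‖ ≤ (∑ i, ∑ j, |(S₀ i j : ℝ)|) * (∑ i, |x i|) * ‖z‖ := by
  rw [bil_eq_sum, Finset.sum_mul, Finset.sum_mul]
  refine (norm_sum_le _ _).trans (Finset.sum_le_sum fun i _ => ?_)
  rw [Finset.sum_mul, Finset.sum_mul]
  refine (norm_sum_le _ _).trans (Finset.sum_le_sum fun j _ => ?_)
  have h1 : |x i| ≤ ∑ i, |x i| :=
    Finset.single_le_sum (f := fun i => |x i|) (fun _ _ => abs_nonneg _) (Finset.mem_univ i)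
  have h2 := norm_le_pi_norm z j
  rw [norm_mul, norm_mul, Complex.norm_real, Complex.norm_intCast, Real.norm_eq_abs,
    mul_comm |x i|]
  gcongr

lemma abs_bil_self_le (S₀ : Matrix (Fin s) (Fin s) ℤ) (x : Fin s → ℝ) :
    |bil S₀ x x| ≤ (∑ i, ∑ j, |(S₀ i j : ℝ)|) * (∑ i, |x i|) ^ 2 := by
  have h := norm_bil_le S₀ x fun i => (x i : ℂ)
  rw [bil_ofReal, Complex.norm_real, Real.norm_eq_abs] at h
  refine h.trans ?_
  rw [sq, ← mul_assoc]
  gcongr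
  refine (pi_norm_le_iff_of_nonneg (by positivity)).2 fun i => ?_
  rw [Complex.norm_real, Real.norm_eq_abs]
  exact Finset.single_le_sum (f := fun i => |x i|) (fun _ _ => abs_nonneg _) (Finset.mem_univ i)

/-- The growth in x is quadratic. Bounding it by exp ∑|xᵢ| lets it be absorbed into the linear term
of a Gaussian exponent. -/
lemma norm_thetaArg_le (S₀ : Matrix (Fin s) (Fin s) ℤ) (x : Fin s → ℝ) :
    ‖thetaArg S₀ x‖ ≤ 2 * Real.pi * (∑ i, ∑ j, |(S₀ i j : ℝ)|) * Real.exp (∑ i, |x i|) := by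
  set K := ∑ i, ∑ j, |(S₀ i j : ℝ)|
  set N := ∑ i, |x i|
  have hN : 0 ≤ N := by positivity
  have hK : 0 ≤ K := by positivity
  refine ContinuousLinearMap.opNorm_le_bound _ (by positivity) fun p => ?_
  have h1 : ‖((bil S₀ x x : ℝ) : ℂ) / 2 * p.1‖ ≤ K * N ^ 2 / 2 * ‖p‖ := by
    rw [norm_mul, norm_div, Complex.norm_real, Real.norm_eq_abs, Complex.norm_ofNat]
    have := abs_bil_self_le S₀ x
    have := norm_fst_le p
    gcongr
  have h2 : ‖bil S₀ (fun i => (x i : ℂ)) p.2‖ ≤ K * N * ‖p‖ := by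
    refine (norm_bil_le S₀ x p.2).trans ?_
    have := norm_snd_le p
    gcongr
  have h3 := Real.quadratic_le_exp_of_nonneg hN
  rw [thetaArg_apply, norm_mul]
  have h4 : ‖(2 * Real.pi * Complex.I : ℂ)‖ = 2 * Real.pi := by
    simp [abs_of_pos Real.pi_pos]
  rw [h4, mul_assoc (2 * Real.pi) K, mul_assoc (2 * Real.pi)]
  refine mul_le_mul_of_nonneg_left ?_ (by positivity : (0 : ℝ) ≤ 2 * Real.pi)
  refine (norm_add_le _ _).trans ((add_le_add h1 h2).trans ?_)
  have : K * N ^ 2 / 2 * ‖p‖ + K * N * ‖p‖ = K * (N + N ^ 2 / 2) * ‖p‖ := by ring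
  rw [this]
  gcongr
  linarith

/-- The quadratic decay comes from S₀[x] Im τ ≥ cδ|x|², while z contributes at most linear growth in
x. -/
lemma norm_exp_thetaArg_le {S₀ : Matrix (Fin s) (Fin s) ℤ} {c : ℝ}
    (hc : ∀ x : Fin s → ℝ, c * ∑ i, x i ^ 2 ≤ bil S₀ x x) (hc0 : 0 < c) {δ R : ℝ} (hδ : 0 < δ)
    (x : Fin s → ℝ) (p : ℂ × (Fin s → ℂ)) (h1 : δ ≤ p.1.im) (h2 : ‖p.2‖ ≤ R) :
    ‖Complex.exp (thetaArg S₀ x p)‖ ≤ Real.exp (-(Real.pi * δ * c) * ∑ i, x i ^ 2 +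
      2 * Real.pi * (∑ i, ∑ j, |(S₀ i j : ℝ)|) * R * ∑ i, |x i|) := by
  rw [Complex.norm_exp, Real.exp_le_exp]
  set K := ∑ i, ∑ j, |(S₀ i j : ℝ)|
  set N := ∑ i, |x i|
  have hN : 0 ≤ N := by positivity
  have hK : 0 ≤ K := by positivity
  have h3 : |(bil S₀ (fun i => (x i : ℂ)) p.2).im| ≤ K * N * R :=
    (Complex.abs_im_le_norm _).trans ((norm_bil_le S₀ x p.2).trans (by gcongr))
  have h4 : (thetaArg S₀ x p).re =
      -(Real.pi * (bil S₀ x x * p.1.im)) -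
        2 * Real.pi * (bil S₀ (fun i => (x i : ℂ)) p.2).im := by
    rw [thetaArg_apply, show (2 * Real.pi * Complex.I *
      (((bil S₀ x x : ℝ) : ℂ) / 2 * p.1 + bil S₀ (fun i => (x i : ℂ)) p.2)) =
      ((Real.pi * bil S₀ x x : ℝ) : ℂ) * (p.1 * Complex.I) +
      ((2 * Real.pi : ℝ) : ℂ) * (bil S₀ (fun i => (x i : ℂ)) p.2 * Complex.I) by
        push_cast; ring, Complex.add_re, Complex.re_ofReal_mul, Complex.re_ofReal_mul,
        Complex.mul_I_re, Complex.mul_I_re]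
    ring
  rw [h4]
  have h5 : c * (∑ i, x i ^ 2) * δ ≤ bil S₀ x x * p.1.im :=
    mul_le_mul (hc x) h1 hδ.le (le_trans (by positivity) (hc x))
  have h6 := (abs_le.1 h3).1
  have h7 : Real.pi * (c * (∑ i, x i ^ 2) * δ) ≤ Real.pi * (bil S₀ x x * p.1.im) := by
    have := Real.pi_pos
    gcongr
  nlinarith [Real.pi_pos]

/-- The factor 1 + ‖thetaArg‖ makes one majorant serve the theta series and its termwise derivative.
It costs only the extra +1 in the linear coefficient of the exponent. -/
lemma exists_summable_bound {S₀ : Matrix (Fin s) (Fin s) ℤ}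
    (hpos : (S₀.map (Int.cast : ℤ → ℝ)).PosDef) {δ : ℝ} (hδ : 0 < δ) (R : ℝ) :
    ∃ u : (Fin s → ℤ) → ℝ, Summable u ∧ ∀ n (p : ℂ × (Fin s → ℂ)), δ ≤ p.1.im → ‖p.2‖ ≤ R →
      ‖Complex.exp (thetaArg S₀ (fun i => (n i : ℝ)) p)‖ *
        (1 + ‖thetaArg S₀ (fun i => (n i : ℝ))‖) ≤ u n := by
  obtain ⟨c, hc0, hc⟩ := exists_mul_sum_sq_le_bil hpos
  set K := ∑ i, ∑ j, |(S₀ i j : ℝ)| with hKdef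
  have hK : 0 ≤ K := by positivity
  have ha : 0 < Real.pi * δ * c := by positivity
  refine ⟨_, (summable_exp_neg_sum ha (2 * Real.pi * K * R + 1)).mul_left (1 + 2 * Real.pi * K),
    fun n p h1 h2 => ?_⟩
  have h3 := norm_exp_thetaArg_le hc hc0 hδ (fun i => (n i : ℝ)) p h1 h2
  have h4 := norm_thetaArg_le S₀ fun i => (n i : ℝ)
  rw [← hKdef] at h3 h4
  have h5 : (1 : ℝ) ≤ Real.exp (∑ i, |(n i : ℝ)|) := Real.one_le_exp (by positivity)
  refine (mul_le_mul h3 (c := 1 + ‖thetaArg S₀ fun i => (n i : ℝ)‖)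
    (d := (1 + 2 * Real.pi * K) * Real.exp (∑ i, |(n i : ℝ)|)) (by linarith) (by positivity)
    (by positivity)).trans (le_of_eq ?_)
  rw [mul_left_comm, ← Real.exp_add]
  congr 2
  ring

lemma summable_theta {S₀ : Matrix (Fin s) (Fin s) ℤ}
    (hpos : (S₀.map (Int.cast : ℤ → ℝ)).PosDef) {p : ℂ × (Fin s → ℂ)} (hp : p ∈ dom s) :
    Summable fun n : Fin s → ℤ => Complex.exp (thetaArg S₀ (fun i => (n i : ℝ)) p) := by
  obtain ⟨u, hu, h⟩ := exists_summable_bound hpos hp ‖p.2‖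
  refine Summable.of_norm_bounded hu fun n => le_trans ?_ (h n p le_rfl le_rfl)
  exact le_mul_of_one_le_right (norm_nonneg _) (by simp)

lemma differentiableOn_theta {S₀ : Matrix (Fin s) (Fin s) ℤ}
    (hpos : (S₀.map (Int.cast : ℤ → ℝ)).PosDef) : DifferentiableOn ℂ (theta S₀) (dom s) := by
  intro p hp
  have hp' : 0 < p.1.im := hp
  obtain ⟨u, hu, h⟩ := exists_summable_bound hpos (half_pos hp') (‖p.2‖ + 1)
  set U : Set (ℂ × (Fin s → ℂ)) := Metric.ball p (min (p.1.im / 2) 1)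
  have hU : ∀ q ∈ U, p.1.im / 2 ≤ q.1.im ∧ ‖q.2‖ ≤ ‖p.2‖ + 1 := by
    intro q hq
    have hq' : ‖q - p‖ < min (p.1.im / 2) 1 := by simpa [U, dist_eq_norm] using hq
    have h1 := (norm_fst_le (q - p)).trans_lt hq'
    have h2 := (norm_snd_le (q - p)).trans_lt hq'
    have h3 := (Complex.abs_im_le_norm (q - p).1).trans_lt (h1.trans_le (min_le_left _ _))
    have h4 : ‖q.2 - p.2‖ < 1 := h2.trans_le (min_le_right _ _)
    simp only [Prod.fst_sub, Complex.sub_im] at h3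
    refine ⟨by linarith [(abs_lt.1 h3).1], ?_⟩
    have := norm_add_le p.2 (q.2 - p.2)
    rw [add_sub_cancel] at this
    linarith
  have hpU : p ∈ U := Metric.mem_ball_self (by positivity)
  have hder : ∀ (n : Fin s → ℤ) (q : ℂ × (Fin s → ℂ)), q ∈ U →
      HasFDerivAt (fun q => Complex.exp (thetaArg S₀ (fun i => (n i : ℝ)) q))
        (Complex.exp (thetaArg S₀ (fun i => (n i : ℝ)) q) •
          thetaArg S₀ (fun i => (n i : ℝ))) q := fun n q _ =>
    (thetaArg S₀ (fun i => (n i : ℝ))).hasFDerivAt.cexp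
  have hbound : ∀ (n : Fin s → ℤ) (q : ℂ × (Fin s → ℂ)), q ∈ U →
      ‖Complex.exp (thetaArg S₀ (fun i => (n i : ℝ)) q) •
        thetaArg S₀ (fun i => (n i : ℝ))‖ ≤ u n := by
    intro n q hq
    refine le_trans ?_ (h n q (hU q hq).1 (hU q hq).2)
    rw [norm_smul]
    exact mul_le_mul_of_nonneg_left (by linarith) (norm_nonneg _)
  have := hasFDerivAt_tsum_of_isPreconnected (𝕜 := ℂ) hu (s := U) Metric.isOpen_ball
    (convex_ball p _).isPreconnected
    hder hbound
    hpU (summable_theta hpos hp) hpU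
  exact this.differentiableAt.differentiableWithinAt

open MeasureTheory

/-! ### Poisson summation on `ℤ^s` -/

/-- The reduction map `ℝ^s → (ℝ/ℤ)^s`. -/
def toTorus (x : Fin s → ℝ) : UnitAddTorus (Fin s) := fun i => (x i : UnitAddCircle)

lemma isOpenQuotientMap_toTorus : IsOpenQuotientMap (toTorus (s := s)) :=
  IsOpenQuotientMap.piMap fun _ => QuotientAddGroup.isOpenQuotientMap_mk

lemma exists_eq_add_of_toTorus_eq {x y : Fin s → ℝ} (h : toTorus x = toTorus y) :
    ∃ n : Fin s → ℤ, x = y + fun i => (n i : ℝ) := by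
  have : ∀ i, ∃ n : ℤ, (n : ℝ) = x i - y i := by
    intro i
    have hi : (x i : UnitAddCircle) = y i := congrFun h i
    rw [← sub_eq_zero, ← AddCircle.coe_sub, AddCircle.coe_eq_zero_iff] at hi
    simpa using hi
  choose n hn using this
  refine ⟨n, funext fun i => ?_⟩
  rw [Pi.add_apply, hn]
  ring

lemma mFourier_toTorus (m : Fin s → ℤ) (x : Fin s → ℝ) :
    UnitAddTorus.mFourier m (toTorus x) =
      Complex.exp (2 * Real.pi * Complex.I * ∑ i, (m i : ℂ) * x i) := by
  simp only [UnitAddTorus.mFourier, ContinuousMap.coe_mk, toTorus, fourier_coe_apply,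
    ← Complex.exp_sum, Finset.mul_sum]
  congr 1
  refine Finset.sum_congr rfl fun i _ => ?_
  push_cast
  ring

/-- Half-open unit cubes. -/
def cube (n : Fin s → ℤ) : Set (Fin s → ℝ) := {x | ∀ i, x i ∈ Set.Ioc (n i : ℝ) (n i + 1)}

lemma measurableSet_cube (n : Fin s → ℤ) : MeasurableSet (cube n) :=
  MeasurableSet.univ_pi' fun _ => measurableSet_Ioc

lemma norm_le_of_mem_cube {x : Fin s → ℝ} (hx : x ∈ cube 0) : ‖x‖ ≤ 1 := by
  refine (pi_norm_le_iff_of_nonneg zero_le_one).2 fun i => ?_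
  have := hx i
  simp only [Pi.zero_apply, Int.cast_zero, zero_add, Set.mem_Ioc] at this
  rw [Real.norm_eq_abs, abs_le]
  constructor <;> linarith

lemma hasSum_integral_cube {h : (Fin s → ℝ) → ℂ} (hh : Integrable h) :
    HasSum (fun n : Fin s → ℤ => ∫ x in cube 0, h (x + fun i => (n i : ℝ))) (∫ x, h x) := by
  have hun : ⋃ n : Fin s → ℤ, cube n = Set.univ := by
    -- The cubes are open on the left, so the corner is ⌈x⌉ - 1 and not ⌊x⌋.
    refine Set.eq_univ_of_forall fun x => Set.mem_iUnion.2 ⟨fun i => ⌈x i⌉ - 1, fun i => ?_⟩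
    have h1 := Int.ceil_lt_add_one (x i)
    have h2 := Int.le_ceil (x i)
    push_cast
    constructor <;> linarith
  have hdisj : Pairwise (Function.onFun Disjoint (cube (s := s))) := by
    intro m n hmn
    refine Set.disjoint_left.2 fun x hm hn => hmn (funext fun i => ?_)
    obtain ⟨h1, h2⟩ := hm i
    obtain ⟨h3, h4⟩ := hn i
    have h5 : m i < n i + 1 := by exact_mod_cast h1.trans_le h4
    have h6 : n i < m i + 1 := by exact_mod_cast h3.trans_le h2
    omega
  have := hasSum_integral_iUnion (μ := volume) (f := h) measurableSet_cube hdisj hh.integrableOn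
  rw [hun, setIntegral_univ] at this
  refine this.congr_fun fun n => ?_
  refine Eq.trans ?_ ((measurePreserving_add_right volume
    fun i => (n i : ℝ)).setIntegral_preimage_emb (measurableEmbedding_addRight _) h (cube n))
  congr 2
  ext x
  simp only [cube, Set.mem_ofPred_eq, Set.mem_preimage, Pi.add_apply, Pi.zero_apply, Set.mem_Ioc]
  refine forall_congr' fun i => ?_
  push_cast
  constructor <;> rintro ⟨h1, h2⟩ <;> constructor <;> linarith

/-- Poisson summation: the periodization G of g descends to a continuous function F on the torus,
whose Fourier coefficients unfold to integrals over ℝ^s. Their summability allows the Fourier series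
to be evaluated at 0. -/
theorem tsum_eq_tsum_fourierIntegral {g : (Fin s → ℝ) → ℂ} (hg : Continuous g)
    (hint : Integrable g)
    (hb : ∀ R : ℝ, ∃ u : (Fin s → ℤ) → ℝ, Summable u ∧
      ∀ n (x : Fin s → ℝ), ‖x‖ ≤ R → ‖g (x + fun i => (n i : ℝ))‖ ≤ u n)
    (hsum : Summable fun m : Fin s → ℤ =>
      ∫ x : Fin s → ℝ, Complex.exp (2 * Real.pi * Complex.I * ∑ i, ((-m) i : ℂ) * x i) * g x) :
    ∑' n : Fin s → ℤ, g (fun i => (n i : ℝ)) = ∑' m : Fin s → ℤ,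
      ∫ x : Fin s → ℝ, Complex.exp (2 * Real.pi * Complex.I * ∑ i, ((-m) i : ℂ) * x i) * g x := by
  set G : (Fin s → ℝ) → ℂ := fun x => ∑' n : Fin s → ℤ, g (x + fun i => (n i : ℝ)) with hG
  have hGper : ∀ x y, toTorus x = toTorus y → G x = G y := by
    intro x y hxy
    obtain ⟨k, rfl⟩ := exists_eq_add_of_toTorus_eq hxy
    rw [hG]
    dsimp only
    rw [← (Equiv.addLeft k).tsum_eq fun n : Fin s → ℤ => g (y + fun i => (n i : ℝ))]
    refine tsum_congr fun n => ?_
    congr 1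
    ext i
    simp [add_assoc]
  have hGcont : Continuous G := by
    refine continuous_iff_continuousAt.2 fun x => ?_
    obtain ⟨u, hu, h⟩ := hb (‖x‖ + 1)
    have hon : ContinuousOn G (Metric.closedBall 0 (‖x‖ + 1)) :=
      continuousOn_tsum (fun n => by fun_prop) hu fun n y hy => h n y (by simpa using hy)
    refine hon.continuousAt (Filter.mem_of_superset (Metric.ball_mem_nhds x one_pos) fun y hy => ?_)
    rw [mem_closedBall_zero_iff]
    rw [Metric.mem_ball, dist_eq_norm] at hy
    have := norm_add_le x (y - x)
    rw [add_sub_cancel] at this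
    linarith
  -- The section r need not be continuous: G is periodic, so G ∘ r is continuous by the quotient
  -- topology.
  obtain ⟨r, hr⟩ := isOpenQuotientMap_toTorus (s := s).surjective.hasRightInverse
  set F : C(UnitAddTorus (Fin s), ℂ) := ⟨fun t => G (r t), by
    rw [isOpenQuotientMap_toTorus.isQuotientMap.continuous_iff]
    exact hGcont.congr fun x => (hGper _ _ (hr _)).symm⟩ with hF
  have hFG : ∀ x, F (toTorus x) = G x := fun x => hGper _ _ (hr _)
  have hcoef : ∀ m : Fin s → ℤ, UnitAddTorus.mFourierCoeff F m =
      ∫ x : Fin s → ℝ, Complex.exp (2 * Real.pi * Complex.I * ∑ i, ((-m) i : ℂ) * x i) * g x := by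
    intro m
    set e : (Fin s → ℝ) → ℂ := fun x => UnitAddTorus.mFourier (-m) (toTorus x) with he
    have hecont : Continuous e := (UnitAddTorus.mFourier (-m)).continuous.comp
      isOpenQuotientMap_toTorus.continuous
    have henorm : ∀ x, ‖e x‖ ≤ 1 := fun x =>
      ((UnitAddTorus.mFourier (-m)).norm_coe_le_norm _).trans UnitAddTorus.mFourier_norm.le
    have heper : ∀ x (n : Fin s → ℤ), e (x + fun i => (n i : ℝ)) = e x := by
      intro x n
      simp only [he]
      congr 1
      ext i
      simp [toTorus]
    have heg : (fun x : Fin s → ℝ => Complex.exp (2 * Real.pi * Complex.I *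
        ∑ i, ((-m) i : ℂ) * x i) * g x) = fun x => e x * g x := by
      funext x
      rw [he]
      dsimp only
      rw [mFourier_toTorus]
    rw [heg, UnitAddTorus.mFourierCoeff_eq_integral _ m 0]
    have hint' : Integrable fun x => e x * g x :=
      hint.bdd_mul hecont.aestronglyMeasurable (Filter.Eventually.of_forall henorm)
    have h1 := hasSum_integral_cube hint'
    obtain ⟨u, hu, h⟩ := hb 1
    have hvol : volume (cube (0 : Fin s → ℤ)) ≠ ⊤ := by
      have : cube (0 : Fin s → ℤ) ⊆ Metric.closedBall 0 1 := fun x hx =>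
        mem_closedBall_zero_iff.2 (norm_le_of_mem_cube hx)
      exact ((measure_mono this).trans_lt measure_closedBall_lt_top).ne
    -- The character e is periodic, so dominated convergence recombines the integrals over
    -- translates of the cube into the integral of eG.
    have h2 : HasSum (fun n : Fin s → ℤ => ∫ x in cube 0,
        e (x + fun i => (n i : ℝ)) * g (x + fun i => (n i : ℝ))) (∫ x in cube 0, e x * G x) := by
      refine hasSum_integral_of_dominated_convergence (fun n _ => u n) (fun n => ?_) (fun n => ?_)
        (Filter.Eventually.of_forall fun _ => hu) ?_ ?_
      · exact Continuous.aestronglyMeasurable (by fun_prop)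
      · filter_upwards [ae_restrict_mem (measurableSet_cube 0)] with x hx
        rw [norm_mul]
        exact (mul_le_of_le_one_left (norm_nonneg _) (henorm _)).trans
          (h n x (norm_le_of_mem_cube hx))
      · exact integrableOn_const hvol
      · filter_upwards [ae_restrict_mem (measurableSet_cube 0)] with x hx
        simp only [heper]
        exact (Summable.of_norm_bounded hu fun n =>
          h n x (norm_le_of_mem_cube hx)).hasSum.mul_left (e x)
    rw [h1.unique h2]
    have hset : {x : Fin s → ℝ | ∀ i, x i ∈ Set.Ioc ((0 : Fin s → ℝ) i) ((0 : Fin s → ℝ) i + 1)} =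
        cube 0 := by
      simp [cube]
    rw [hset]
    refine setIntegral_congr_fun (measurableSet_cube 0) fun x _ => ?_
    change e x * F (toTorus x) = e x * G x
    rw [hFG]
  have hsum' : Summable (UnitAddTorus.mFourierCoeff F) := by
    rw [funext hcoef]; exact hsum
  have key := (UnitAddTorus.hasSum_mFourier_series_apply_of_summable hsum' (toTorus 0)).tsum_eq
  rw [hFG] at key
  simp only [hG, zero_add] at key
  rw [← key]
  refine tsum_congr fun m => ?_
  rw [hcoef, mFourier_toTorus]
  simp

/-! ### Gaussian integrals -/

lemma measurePreserving_mulVec {B : Matrix (Fin s) (Fin s) ℝ} (hB : |B.det| = 1) :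
    MeasurePreserving B.mulVec volume volume ∧ MeasurableEmbedding B.mulVec := by
  have h0 : B.det ≠ 0 := by
    intro h
    simp [h] at hB
  constructor
  · refine ⟨by fun_prop, ?_⟩
    have := Real.map_matrix_volume_pi_eq_smul_volume_pi h0
    rw [abs_inv, hB] at this
    have hlin : B.mulVec = Matrix.toLin' B := rfl
    rw [hlin]
    simpa using this
  · have hu : IsUnit B.det := isUnit_iff_ne_zero.2 h0
    exact (Homeomorph.mk ⟨B.mulVec, B⁻¹.mulVec,
      fun x => by rw [Matrix.mulVec_mulVec, Matrix.nonsing_inv_mul _ hu, Matrix.one_mulVec],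
      fun x => by rw [Matrix.mulVec_mulVec, Matrix.mul_nonsing_inv _ hu, Matrix.one_mulVec]⟩
      (by fun_prop) (by fun_prop)).measurableEmbedding

lemma bil_eq_dotProduct {S₀ : Matrix (Fin s) (Fin s) ℤ} {B : Matrix (Fin s) (Fin s) ℝ}
    (hB : B.transpose * B = S₀.map (Int.cast : ℤ → ℝ)) (v w : Fin s → ℂ) :
    bil S₀ v w = ∑ i, (B.map (Complex.ofReal : ℝ → ℂ)).mulVec v i *
      (B.map (Complex.ofReal : ℝ → ℂ)).mulVec w i := by
  have h : S₀.map (Int.cast : ℤ → ℂ) = (B.map (Complex.ofReal : ℝ → ℂ)).transpose *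
      B.map (Complex.ofReal : ℝ → ℂ) := by
    have := congrArg (fun M : Matrix (Fin s) (Fin s) ℝ => M.map Complex.ofRealHom) hB
    simp only [Matrix.map_mul, Matrix.map_map] at this
    rw [← Matrix.transpose_map]
    refine Eq.trans ?_ this.symm
    ext i j
    simp
  rw [bil, h, ← Matrix.mulVec_mulVec, Matrix.dotProduct_mulVec, Matrix.vecMul_transpose]
  rfl

lemma abs_det_eq_one {S₀ : Matrix (Fin s) (Fin s) ℤ}
    (hpos : (S₀.map (Int.cast : ℤ → ℝ)).PosDef) (hu : IsUnit S₀)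
    {B : Matrix (Fin s) (Fin s) ℝ} (hB : B.transpose * B = S₀.map (Int.cast : ℤ → ℝ)) :
    |B.det| = 1 := by
  have h := congrArg Matrix.det hB
  have hd : (S₀.map (Int.cast : ℤ → ℝ)).det = (S₀.det : ℝ) :=
    ((Int.castRingHom ℝ).map_det S₀).symm
  rw [Matrix.det_mul, Matrix.det_transpose, hd] at h
  have hp := hpos.det_pos
  rw [hd] at hp
  have h1 : S₀.det = 1 := by
    rcases Int.isUnit_iff.1 ((Matrix.isUnit_iff_isUnit_det _).1 hu) with h | h
    · exact h
    · rw [h] at hp; norm_num at hp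
  rw [h1, Int.cast_one] at h
  rw [← sq_eq_sq₀ (abs_nonneg _) zero_le_one, sq_abs, sq, h, one_pow]

/-- Substituting v = Bx, with |det B| = 1 by unimodularity, leaves a standard Gaussian with
parameter b = -πiτ, so π/b = i/τ. Since s = 2k, the power s/2 is integral and no branch has to be
chosen. -/
lemma integral_exp_thetaArg {S₀ : Matrix (Fin s) (Fin s) ℤ}
    (hpos : (S₀.map (Int.cast : ℤ → ℝ)).PosDef) (hu : IsUnit S₀) {τ : ℂ} (hτ : 0 < τ.im)
    {k : ℕ} (hk : s = 2 * k) (w : Fin s → ℂ) :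
    Integrable (fun x : Fin s → ℝ => Complex.exp (thetaArg S₀ x (τ, w))) ∧
    ∫ x : Fin s → ℝ, Complex.exp (thetaArg S₀ x (τ, w)) =
      (Complex.I / τ) ^ k * Complex.exp (-(Real.pi * Complex.I * bil S₀ w w / τ)) := by
  obtain ⟨B, hB⟩ := exists_transpose_mul_self hpos
  obtain ⟨hmp, hme⟩ := measurePreserving_mulVec (abs_det_eq_one hpos hu hB)
  have hτ0 : τ ≠ 0 := by rintro rfl; simp at hτ
  set b : ℂ := -(Real.pi * Complex.I * τ) with hbdef
  set c : Fin s → ℂ := fun i => 2 * Real.pi * Complex.I *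
    (B.map (Complex.ofReal : ℝ → ℂ)).mulVec w i with hc
  have hb : 0 < b.re := by
    have : b = ((Real.pi : ℝ) : ℂ) * -(τ * Complex.I) := by rw [hbdef]; ring
    rw [this, Complex.re_ofReal_mul, Complex.neg_re, Complex.mul_I_re, neg_neg]
    exact mul_pos Real.pi_pos hτ
  have hcast : ∀ x : Fin s → ℝ, (B.map (Complex.ofReal : ℝ → ℂ)).mulVec (fun i => (x i : ℂ)) =
      fun i => ((B.mulVec x i : ℝ) : ℂ) := by
    intro x
    ext i
    simp [Matrix.mulVec, dotProduct]
  have hfun : (fun x : Fin s → ℝ => Complex.exp (thetaArg S₀ x (τ, w))) =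
      (fun v : Fin s → ℝ => Complex.exp (-b * ∑ i, (v i : ℂ) ^ 2 + ∑ i, c i * v i)) ∘
        B.mulVec := by
    funext x
    simp only [Function.comp_apply]
    rw [thetaArg_apply, ← bil_ofReal, bil_eq_dotProduct hB, bil_eq_dotProduct hB, hcast]
    congr 1
    simp only [hc, hbdef, mul_add, Finset.mul_sum, Finset.sum_div, Finset.sum_mul]
    congr 1
    · exact Finset.sum_congr rfl fun i _ => by ring
    · exact Finset.sum_congr rfl fun i _ => by ring
  rw [hfun]
  refine ⟨(hmp.integrable_comp_emb hme).2 (GaussianFourier.integrable_cexp_neg_mul_sum_add hb c), ?_⟩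
  have hI := hmp.integral_comp hme
    (fun v : Fin s → ℝ => Complex.exp (-b * ∑ i, (v i : ℂ) ^ 2 + ∑ i, c i * v i))
  simp only [Function.comp_def]
  rw [hI, GaussianFourier.integral_cexp_neg_mul_sum_add hb c]
  congr 1
  · have h1 : (Fintype.card (Fin s) / 2 : ℂ) = (k : ℂ) := by
      rw [Fintype.card_fin, hk]; push_cast; ring
    rw [h1, Complex.cpow_natCast]
    congr 1
    rw [hbdef]
    have := Complex.ofReal_ne_zero.2 Real.pi_ne_zero
    field_simp
    simp
  · congr 1
    have h1 : ∑ i, c i ^ 2 = -4 * Real.pi ^ 2 * bil S₀ w w := by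
      rw [bil_eq_dotProduct hB, Finset.mul_sum]
      refine Finset.sum_congr rfl fun i _ => ?_
      simp only [hc, mul_pow, Complex.I_sq]
      ring
    rw [h1, hbdef]
    have := Complex.ofReal_ne_zero.2 Real.pi_ne_zero
    field_simp
    simp

/-- Poisson summation for x ↦ exp(thetaArg x (τ, z)). The frequency S₀m replaces z by z - m in the
Gaussian integral, which yields the m-th term of theta at (-1/τ, z/τ). Unimodularity makes m ↦ S₀m a
bijection of ℤ^s, so every frequency occurs once. -/
theorem theta_neg_inv {S₀ : Matrix (Fin s) (Fin s) ℤ}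
    (hpos : (S₀.map (Int.cast : ℤ → ℝ)).PosDef) (hu : IsUnit S₀) {k : ℕ} (hk : s = 2 * k)
    {τ : ℂ} (hτ : 0 < τ.im) (z : Fin s → ℂ) :
    theta S₀ (-1 / τ, τ⁻¹ • z) = (-Complex.I * τ) ^ k *
      Complex.exp (Real.pi * Complex.I * bil S₀ z z / τ) * theta S₀ (τ, z) := by
  have hS := transpose_eq_of_posDef hpos
  have hτ0 : τ ≠ 0 := by rintro rfl; simp at hτ
  have hτ' : 0 < (-1 / τ).im := by
    rw [neg_div, one_div, Complex.neg_im, Complex.inv_im, neg_div, neg_neg]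
    exact div_pos hτ (Complex.normSq_pos.2 hτ0)
  set g : (Fin s → ℝ) → ℂ := fun x => Complex.exp (thetaArg S₀ x (τ, z)) with hg
  have hgcont : Continuous g := by
    simp only [hg, thetaArg_apply, bil_eq_sum]
    fun_prop
  have hdet : IsUnit S₀.det := (Matrix.isUnit_iff_isUnit_det _).1 hu
  set σ : (Fin s → ℤ) ≃ (Fin s → ℤ) := ⟨S₀.mulVec, S₀⁻¹.mulVec,
      fun x => by rw [Matrix.mulVec_mulVec, Matrix.nonsing_inv_mul _ hdet, Matrix.one_mulVec],
      fun x => by rw [Matrix.mulVec_mulVec, Matrix.mul_nonsing_inv _ hdet, Matrix.one_mulVec]⟩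
    with hσ
  have hcoef : ∀ m : Fin s → ℤ,
      (∫ x : Fin s → ℝ, Complex.exp (2 * Real.pi * Complex.I * ∑ i, ((-σ m) i : ℂ) * x i) * g x) =
      (Complex.I / τ) ^ k * Complex.exp (-(Real.pi * Complex.I * bil S₀ z z / τ)) *
        Complex.exp (thetaArg S₀ (fun i => (m i : ℝ)) (-1 / τ, τ⁻¹ • z)) := by
    intro m
    have h1 : (fun x : Fin s → ℝ => Complex.exp (2 * Real.pi * Complex.I *
        ∑ i, ((-σ m) i : ℂ) * x i) * g x) =
        fun x => Complex.exp (thetaArg S₀ x (τ, z + -fun i => (m i : ℂ))) := by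
      funext x
      rw [hg]
      dsimp only
      rw [← Complex.exp_add, thetaArg_apply, thetaArg_apply]
      congr 1
      have h2 : ∑ i, ((-σ m) i : ℂ) * x i = -bil S₀ (fun i => (x i : ℂ)) fun i => (m i : ℂ) := by
        rw [bil_eq_sum, ← Finset.sum_neg_distrib]
        refine Finset.sum_congr rfl fun i _ => ?_
        have h3 : (-σ m) i = -∑ j, S₀ i j * m j := rfl
        rw [h3]
        push_cast
        rw [neg_mul, Finset.sum_mul]
        congr 1
        exact Finset.sum_congr rfl fun j _ => by ring
      rw [h2]
      simp only [bil_add_right, bil_neg_right]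
      ring
    rw [h1, (integral_exp_thetaArg hpos hu hτ hk _).2, mul_assoc ((Complex.I / τ) ^ k),
      ← Complex.exp_add, thetaArg_apply]
    congr 2
    have h3 : ((bil S₀ (fun i => (m i : ℝ)) (fun i => (m i : ℝ)) : ℝ) : ℂ) =
        bil S₀ (fun i => (m i : ℂ)) (fun i => (m i : ℂ)) := by
      rw [← bil_ofReal]; simp
    rw [h3]
    simp only [bil_add_left, bil_add_right, bil_neg_left, bil_neg_right, bil_smul_right,
      bil_comm hS z, Complex.ofReal_intCast]
    field_simp
    ring
  have hsumθ := summable_theta hpos (p := (-1 / τ, τ⁻¹ • z)) hτ'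
  have hb : ∀ R : ℝ, ∃ u : (Fin s → ℤ) → ℝ, Summable u ∧
      ∀ n (x : Fin s → ℝ), ‖x‖ ≤ R → ‖g (x + fun i => (n i : ℝ))‖ ≤ u n := by
    intro R
    obtain ⟨u, hu, h⟩ := exists_summable_bound hpos hτ (‖z‖ + ‖τ‖ * R)
    obtain ⟨C, hC⟩ := (isCompact_closedBall (0 : Fin s → ℝ) R).exists_bound_of_continuousOn
      hgcont.continuousOn
    refine ⟨fun n => max C 0 * u n, hu.mul_left _, fun n x hx => ?_⟩
    -- A shift by x multiplies the n-th term by g(x) and moves z to z + τx, which stays bounded for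
    -- ‖x‖ ≤ R.
    have h1 : g (x + fun i => (n i : ℝ)) = g x *
        Complex.exp (thetaArg S₀ (fun i => (n i : ℝ)) (τ, z + τ • fun i => (x i : ℂ))) := by
      simp only [hg]
      rw [← Complex.exp_add, thetaArg_apply, thetaArg_apply, thetaArg_apply]
      congr 1
      have hadd : (fun i => (((x + fun i => (n i : ℝ)) i : ℝ) : ℂ)) =
          (fun i => (x i : ℂ)) + fun i => (((n i : ℝ)) : ℂ) := by
        ext i; simp
      simp only [← bil_ofReal, hadd]
      simp only [bil_add_left, bil_add_right, bil_smul_right,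
        bil_comm hS (fun i => (x i : ℂ)) fun i => (((n i : ℝ)) : ℂ)]
      ring
    rw [h1, norm_mul]
    refine mul_le_mul ((hC x (mem_closedBall_zero_iff.2 hx)).trans (le_max_left _ _)) ?_
      (norm_nonneg _) (le_max_right _ _)
    refine le_trans (le_mul_of_one_le_right (norm_nonneg _) (by simp)) (h n _ le_rfl ?_)
    refine (norm_add_le _ _).trans ?_
    rw [norm_smul]
    have hx' : ‖fun i => (x i : ℂ)‖ ≤ R := by
      refine (pi_norm_le_iff_of_nonneg ((norm_nonneg _).trans hx)).2 fun i => ?_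
      rw [Complex.norm_real]
      exact (norm_le_pi_norm x i).trans hx
    gcongr
  have hsum : Summable fun m : Fin s → ℤ => ∫ x : Fin s → ℝ,
      Complex.exp (2 * Real.pi * Complex.I * ∑ i, ((-m) i : ℂ) * x i) * g x := by
    rw [← σ.summable_iff]
    exact (hsumθ.mul_left _).congr fun m => (hcoef m).symm
  have key := tsum_eq_tsum_fourierIntegral hgcont
    (integral_exp_thetaArg hpos hu hτ hk z).1 hb hsum
  rw [← σ.tsum_eq fun m : Fin s → ℤ => ∫ x : Fin s → ℝ,
      Complex.exp (2 * Real.pi * Complex.I * ∑ i, ((-m) i : ℂ) * x i) * g x, tsum_congr hcoef, tsum_mul_left] at key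
  change theta S₀ (τ, z) = _ * theta S₀ (-1 / τ, τ⁻¹ • z) at key
  rw [key, ← mul_assoc]
  have h1 : (-Complex.I * τ) ^ k * (Complex.I / τ) ^ k = 1 := by
    rw [← mul_pow]
    have : -Complex.I * τ * (Complex.I / τ) = 1 := by
      field_simp
      simp
    rw [this, one_pow]
  have h2 : Complex.exp (Real.pi * Complex.I * bil S₀ z z / τ) *
      Complex.exp (-(Real.pi * Complex.I * bil S₀ z z / τ)) = 1 := by
    rw [← Complex.exp_add, add_neg_cancel, Complex.exp_zero]
  linear_combination (-theta S₀ (-1 / τ, τ⁻¹ • z) *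
    Complex.exp (Real.pi * Complex.I * bil S₀ z z / τ) *
    Complex.exp (-(Real.pi * Complex.I * bil S₀ z z / τ))) * h1 -
    theta S₀ (-1 / τ, τ⁻¹ • z) * h2

/-! ### The cone over the domain -/

lemma bil_borelEmb_self {S₀ : Matrix (Fin s) (Fin s) ℤ} (Z : Pt s) :
    bil (gramM S₀) (borelEmb S₀ Z) (borelEmb S₀ Z) = 0 := by
  simp [bil_gramM, borelEmb]
  ring

lemma bil_self_decomp {S₀ : Matrix (Fin s) (Fin s) ℤ} (hS : S₀.transpose = S₀) (z : Fin s → ℂ) :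
    bil S₀ z (star z) - ((bil S₀ z z).re : ℂ) =
      ((2 * bil S₀ (fun i => (z i).im) (fun i => (z i).im) : ℝ) : ℂ) := by
  have hz : z = (fun i => ((z i).re : ℂ)) + Complex.I • fun i => ((z i).im : ℂ) := by
    ext i
    simp [mul_comm Complex.I]
  have hz' : star z = (fun i => ((z i).re : ℂ)) + (-Complex.I) • fun i => ((z i).im : ℂ) := by
    ext i
    apply Complex.ext <;> simp
  have h1 : bil S₀ z (star z) = ((bil S₀ (fun i => (z i).re) (fun i => (z i).re) +
      bil S₀ (fun i => (z i).im) (fun i => (z i).im) : ℝ) : ℂ) := by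
    rw [hz']
    nth_rewrite 1 [hz]
    simp only [bil_add_left, bil_add_right, bil_smul_left, bil_smul_right, bil_ofReal,
      bil_comm hS (fun i => (z i).im)]
    push_cast
    linear_combination (-(bil S₀ (fun i => (z i).im) (fun i => (z i).im) : ℝ) : ℂ) *
      Complex.I_mul_I
  have h2 : (bil S₀ z z).re = bil S₀ (fun i => (z i).re) (fun i => (z i).re) -
      bil S₀ (fun i => (z i).im) (fun i => (z i).im) := by
    have : bil S₀ z z = ((bil S₀ (fun i => (z i).re) (fun i => (z i).re) -
      bil S₀ (fun i => (z i).im) (fun i => (z i).im) : ℝ) : ℂ) +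
      ((2 * bil S₀ (fun i => (z i).re) (fun i => (z i).im) : ℝ) : ℂ) * Complex.I := by
      nth_rewrite 1 2 [hz]
      simp only [bil_add_left, bil_add_right, bil_smul_left, bil_smul_right, bil_ofReal,
        bil_comm hS (fun i => (z i).im)]
      push_cast
      linear_combination ((bil S₀ (fun i => (z i).im) (fun i => (z i).im) : ℝ) : ℂ) *
        Complex.I_mul_I
    rw [this, Complex.add_re, Complex.ofReal_re, Complex.re_ofReal_mul, Complex.I_re, mul_zero,
      add_zero]
  rw [h1, h2]
  push_cast
  ring

/-- The inequality defining the tube domain is negativity of the Hermitian norm of p(Z). -/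
lemma bil_borelEmb_star {S₀ : Matrix (Fin s) (Fin s) ℤ} (hS : S₀.transpose = S₀) (Z : Pt s) :
    bil (gramM S₀) (borelEmb S₀ Z) (star (borelEmb S₀ Z)) =
      ((2 * (bil S₀ (fun i => (Z.z i).im) (fun i => (Z.z i).im) -
        2 * Z.ω.im * Z.τ.im) : ℝ) : ℂ) := by
  have h := bil_self_decomp hS Z.z
  have hstar : (fun i => star (Z.z i)) = star Z.z := rfl
  have h2 : (bil S₀ Z.z Z.z - 2 * Z.ω * Z.τ) / 2 +
      star ((bil S₀ Z.z Z.z - 2 * Z.ω * Z.τ) / 2) =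
      (((bil S₀ Z.z Z.z - 2 * Z.ω * Z.τ).re : ℝ) : ℂ) := by
    apply Complex.ext <;> simp; ring
  have h3 : Z.ω * star Z.τ + Z.τ * star Z.ω + ((-2 * Z.ω * Z.τ).re : ℂ) =
      ((4 * Z.ω.im * Z.τ.im : ℝ) : ℂ) := by
    apply Complex.ext <;> simp <;> ring
  have h4 : ((bil S₀ Z.z Z.z - 2 * Z.ω * Z.τ).re : ℂ) =
      ((bil S₀ Z.z Z.z).re : ℂ) + ((-2 * Z.ω * Z.τ).re : ℂ) := by
    rw [← Complex.ofReal_add, ← Complex.add_re]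
    ring_nf
  rw [h4] at h2
  rw [bil_gramM]
  simp only [borelEmb, Sum.elim_inl, Sum.elim_inr, Pi.star_apply, Matrix.cons_val_zero,
    Matrix.cons_val_one, star_one, mul_one, one_mul, hstar]
  push_cast at h h3 ⊢
  linear_combination h - h2 - h3

/-- A description by quantities that the generators of the Jacobi group visibly preserve. The last
condition is the sign of Im τ; Im ω > 0 then follows since S₀ is positive definite. -/
lemma mem_coneD_iff {S₀ : Matrix (Fin s) (Fin s) ℤ}
    (hpos : (S₀.map (Int.cast : ℤ → ℝ)).PosDef) (v : Idx s → ℂ) :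
    v ∈ coneD S₀ ↔ bil (gramM S₀) v v = 0 ∧ (bil (gramM S₀) v (star v)).re < 0 ∧
      0 < (v (.inr (.inr 0)) * star (v (.inr (.inr 1)))).im := by
  have hS := transpose_eq_of_posDef hpos
  have hscale : ∀ (t : ℂ) (Z : Pt s), (bil (gramM S₀) (t • borelEmb S₀ Z)
      (star (t • borelEmb S₀ Z))).re = Complex.normSq t *
        (2 * (bil S₀ (fun i => (Z.z i).im) (fun i => (Z.z i).im) - 2 * Z.ω.im * Z.τ.im)) := by
    intro t Z
    rw [star_smul, bil_smul_left, bil_smul_right, bil_borelEmb_star hS, ← mul_assoc]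
    have : t * star t = ((Complex.normSq t : ℝ) : ℂ) := Complex.mul_conj t
    rw [this, Complex.re_ofReal_mul, Complex.ofReal_re]
  constructor
  · rintro ⟨Z, ⟨h1, h2, h3⟩, t, ht, rfl⟩
    have hn := Complex.normSq_pos.2 ht
    refine ⟨?_, ?_, ?_⟩
    · rw [bil_smul_left, bil_smul_right, bil_borelEmb_self, mul_zero, mul_zero]
    · rw [hscale]
      exact mul_neg_of_pos_of_neg hn (by linarith)
    · simp only [borelEmb, Pi.smul_apply, Sum.elim_inr, smul_eq_mul, Matrix.cons_val_zero,
        Matrix.cons_val_one, mul_one]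
      have : t * Z.τ * star t = ((Complex.normSq t : ℝ) : ℂ) * Z.τ := by
        rw [← Complex.mul_conj t]
        change _ = t * star t * _
        ring
      rw [this, Complex.im_ofReal_mul]
      exact mul_pos hn h2
  · rintro ⟨h1, h2, h3⟩
    set t := v (.inr (.inr 1)) with ht
    have ht0 : t ≠ 0 := by
      intro h
      rw [h] at h3
      simp at h3
    set Z : Pt s := ⟨v (.inl 1) / t, fun i => v (.inr (.inl i)) / t, v (.inr (.inr 0)) / t⟩ with hZ
    have hv : v = t • borelEmb S₀ Z := by
      rw [bil_gramM] at h1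
      have hmid : Z.z = t⁻¹ • fun i => v (.inr (.inl i)) := by
        ext i
        simp [hZ, div_eq_inv_mul]
      funext i
      rcases i with i | i | i
      · fin_cases i
        · simp only [borelEmb, Pi.smul_apply, Sum.elim_inl, smul_eq_mul, hmid, bil_smul_left,
            bil_smul_right]
          simp only [hZ, Fin.zero_eta, Matrix.cons_val_zero]
          rw [← ht] at h1
          field_simp
          linear_combination -h1
        · simp [borelEmb, hZ]
          field_simp
      · simp [borelEmb, hZ]
        field_simp
      · fin_cases i
        · simp [borelEmb, hZ]
          field_simp
        · simp [borelEmb, ht]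
    have hn := Complex.normSq_pos.2 ht0
    refine ⟨Z, ?_, t, ht0, hv⟩
    have hneg : bil S₀ (fun i => (Z.z i).im) (fun i => (Z.z i).im) - 2 * Z.ω.im * Z.τ.im < 0 := by
      rw [hv, hscale] at h2
      have := neg_of_mul_neg_right h2 hn.le
      linarith
    have hτ : 0 < Z.τ.im := by
      have hτ' : v (.inr (.inr 0)) * star t = ((Complex.normSq t : ℝ) : ℂ) * Z.τ := by
        rw [← Complex.mul_conj t]
        change _ = t * star t * (_ / t)
        field_simp
      rw [hτ', Complex.im_ofReal_mul] at h3
      exact (mul_pos_iff_of_pos_left hn).1 h3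
    refine ⟨?_, hτ, hneg⟩
    have h4 := bil_self_nonneg hpos fun i => (Z.z i).im
    have h5 : 0 < Z.ω.im * Z.τ.im := by linarith
    exact (mul_pos_iff_of_pos_right hτ).1 h5

/-! ### The action on the domain -/

/-- Matrices that preserve the cone. -/
def PreservesCone (S₀ : Matrix (Fin s) (Fin s) ℤ) (g : Matrix (Idx s) (Idx s) ℝ) : Prop :=
  ∀ v : Idx s → ℂ, (g.map (Complex.ofReal : ℝ → ℂ)).mulVec v ∈ coneD S₀ ↔ v ∈ coneD S₀

lemma borelEmb_mem_coneD {S₀ : Matrix (Fin s) (Fin s) ℤ} {Z : Pt s} (hZ : Z ∈ tube S₀) :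
    borelEmb S₀ Z ∈ coneD S₀ := ⟨Z, hZ, 1, one_ne_zero, (one_smul _ _).symm⟩

lemma PreservesCone.actBorel_eq {S₀ : Matrix (Fin s) (Fin s) ℤ} {g : Matrix (Idx s) (Idx s) ℝ}
    (hg : PreservesCone S₀ g) {Z : Pt s} (hZ : Z ∈ tube S₀) :
    J S₀ g Z ≠ 0 ∧ act S₀ g Z ∈ tube S₀ ∧
      actBorel S₀ g Z = J S₀ g Z • borelEmb S₀ (act S₀ g Z) := by
  obtain ⟨W, hW, t, ht, h⟩ := (hg _).2 (borelEmb_mem_coneD hZ)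
  change actBorel S₀ g Z = _ at h
  have hJ : J S₀ g Z = t := by
    rw [J, h]
    simp [borelEmb]
  have hact : act S₀ g Z = W := by
    rw [act, hJ, h]
    cases W
    simp [borelEmb, ht]
  rw [hJ, hact]
  exact ⟨ht, hW, h⟩

lemma actBorel_mul {S₀ : Matrix (Fin s) (Fin s) ℤ} (g : Matrix (Idx s) (Idx s) ℝ)
    {h : Matrix (Idx s) (Idx s) ℝ} (hh : PreservesCone S₀ h) {Z : Pt s} (hZ : Z ∈ tube S₀) :
    actBorel S₀ (g * h) Z = J S₀ h Z • actBorel S₀ g (act S₀ h Z) := by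
  have hmap : (g * h).map (Complex.ofReal : ℝ → ℂ) =
      g.map (Complex.ofReal : ℝ → ℂ) * h.map (Complex.ofReal : ℝ → ℂ) :=
    Matrix.map_mul (f := Complex.ofRealHom)
  rw [actBorel, hmap, ← Matrix.mulVec_mulVec]
  have h3 := (hh.actBorel_eq hZ).2.2
  rw [actBorel] at h3
  rw [h3, Matrix.mulVec_smul]
  rfl

lemma J_mul {S₀ : Matrix (Fin s) (Fin s) ℤ} (g : Matrix (Idx s) (Idx s) ℝ)
    {h : Matrix (Idx s) (Idx s) ℝ} (hh : PreservesCone S₀ h) {Z : Pt s} (hZ : Z ∈ tube S₀) :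
    J S₀ (g * h) Z = J S₀ h Z * J S₀ g (act S₀ h Z) := by
  rw [J, actBorel_mul g hh hZ]
  rfl

lemma act_mul {S₀ : Matrix (Fin s) (Fin s) ℤ} (g : Matrix (Idx s) (Idx s) ℝ)
    {h : Matrix (Idx s) (Idx s) ℝ} (hh : PreservesCone S₀ h) {Z : Pt s} (hZ : Z ∈ tube S₀) :
    act S₀ (g * h) Z = act S₀ g (act S₀ h Z) := by
  have hJ := (hh.actBorel_eq hZ).1
  rw [act, act, J_mul g hh hZ, actBorel_mul g hh hZ]
  simp [mul_div_mul_left _ _ hJ]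

lemma actBorel_one (S₀ : Matrix (Fin s) (Fin s) ℤ) (Z : Pt s) :
    actBorel S₀ 1 Z = borelEmb S₀ Z := by
  rw [actBorel]
  simp

lemma J_one (S₀ : Matrix (Fin s) (Fin s) ℤ) (Z : Pt s) : J S₀ 1 Z = 1 := by
  rw [J, actBorel_one]
  simp [borelEmb]

lemma act_one (S₀ : Matrix (Fin s) (Fin s) ℤ) (Z : Pt s) : act S₀ 1 Z = Z := by
  cases Z
  rw [act, J_one, actBorel_one]
  simp [borelEmb]

lemma PreservesCone.one (S₀ : Matrix (Fin s) (Fin s) ℤ) : PreservesCone S₀ 1 := by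
  intro v
  simp

lemma PreservesCone.mul {S₀ : Matrix (Fin s) (Fin s) ℤ} {g h : Matrix (Idx s) (Idx s) ℝ}
    (hg : PreservesCone S₀ g) (hh : PreservesCone S₀ h) : PreservesCone S₀ (g * h) := by
  intro v
  have hmap : (g * h).map (Complex.ofReal : ℝ → ℂ) =
      g.map (Complex.ofReal : ℝ → ℂ) * h.map (Complex.ofReal : ℝ → ℂ) :=
    Matrix.map_mul (f := Complex.ofRealHom)
  rw [hmap, ← Matrix.mulVec_mulVec, hg, hh]

lemma PreservesCone.of_mul_eq_one {S₀ : Matrix (Fin s) (Fin s) ℤ}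
    {g h : Matrix (Idx s) (Idx s) ℝ} (hg : PreservesCone S₀ g) (hgh : g * h = 1) :
    PreservesCone S₀ h := by
  intro v
  have hmap : (g * h).map (Complex.ofReal : ℝ → ℂ) =
      g.map (Complex.ofReal : ℝ → ℂ) * h.map (Complex.ofReal : ℝ → ℂ) :=
    Matrix.map_mul (f := Complex.ofRealHom)
  rw [← hg, Matrix.mulVec_mulVec, ← hmap, hgh]
  simp

/-- The elements that leave a function on the domain invariant with respect to the weight `k`
action. -/
def stabilizer (S₀ : Matrix (Fin s) (Fin s) ℤ) (k : ℕ) (Φ : Pt s → ℂ) :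
    Subgroup (GL (Idx s) ℝ) where
  carrier := {g | PreservesCone S₀ (g : Matrix (Idx s) (Idx s) ℝ) ∧ ∀ Z ∈ tube S₀,
    Φ (act S₀ (g : Matrix (Idx s) (Idx s) ℝ) Z) =
      J S₀ (g : Matrix (Idx s) (Idx s) ℝ) Z ^ k * Φ Z}
  one_mem' := ⟨PreservesCone.one S₀, fun Z _ => by simp [act_one, J_one]⟩
  mul_mem' := by
    rintro g h ⟨hg, hg'⟩ ⟨hh, hh'⟩
    refine ⟨hg.mul hh, fun Z hZ => ?_⟩
    rw [Units.val_mul, act_mul _ hh hZ, J_mul _ hh hZ, hg' _ (hh.actBorel_eq hZ).2.1, hh' Z hZ]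
    ring
  inv_mem' := by
    rintro g ⟨hg, hg'⟩
    have hi : PreservesCone S₀ ((g⁻¹ : GL (Idx s) ℝ) : Matrix (Idx s) (Idx s) ℝ) :=
      hg.of_mul_eq_one (Units.mul_inv g)
    refine ⟨hi, fun Z hZ => ?_⟩
    have h1 := hg' _ (hi.actBorel_eq hZ).2.1
    have h2 := J_mul (S₀ := S₀) (g : Matrix (Idx s) (Idx s) ℝ) hi hZ
    rw [← act_mul _ hi hZ, Units.mul_inv, act_one] at h1
    rw [Units.mul_inv, J_one] at h2
    rw [h1, ← mul_assoc, ← mul_pow, ← h2, one_pow, one_mul]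

/-! ### Generators of the Jacobi group -/

lemma upper_mul {R : Type*} [CommRing R] (A A' : Matrix (Fin 2) (Fin 2) R)
    (B B' : Matrix (Fin 2) (Fin s) R) (Y Y' : Matrix (Fin 2) (Fin 2) R)
    (U U' : Matrix (Fin s) (Fin s) R) (X X' : Matrix (Fin s) (Fin 2) R)
    (D D' : Matrix (Fin 2) (Fin 2) R) :
    upper A B Y U X D * upper A' B' Y' U' X' D' =
      upper (A * A') (A * B' + B * U') (A * Y' + (B * X' + Y * D')) (U * U') (U * X' + X * D')
        (D * D') := by
  simp only [upper, Matrix.fromBlocks_multiply, Matrix.mul_fromCols,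
    Matrix.fromCols_mul_fromBlocks, Matrix.mul_zero, Matrix.zero_mul, add_zero, zero_add]
  congr 1
  ext i (j | j) <;> simp

lemma upper_one {R : Type*} [CommRing R] :
    upper (1 : Matrix (Fin 2) (Fin 2) R) 0 0 (1 : Matrix (Fin s) (Fin s) R) 0 1 = 1 := by
  simp [upper]

lemma levi_eq (A : SL(2, ℝ)) :
    levi s A = upper !![A 0 0, -A 0 1; -A 1 0, A 1 1] 0 0 1 0 (A : Matrix (Fin 2) (Fin 2) ℝ) := by
  rw [levi]
  congr 1
  rw [Matrix.SpecialLinearGroup.coe_inv, Matrix.adjugate_fin_two]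
  ext i j
  simp only [Matrix.mul_apply, Fin.sum_univ_two, Matrix.transpose_apply]
  fin_cases i <;> fin_cases j <;> simp [hyp]

lemma det_SL2 (A : SL(2, ℝ)) : A 0 0 * A 1 1 - A 0 1 * A 1 0 = 1 := by
  rw [← Matrix.det_fin_two]
  exact A.2

/-- The embedding of `SL(2, ℝ)` into the Jacobi group. -/
def leviHom (s : ℕ) : SL(2, ℝ) →* Matrix (Idx s) (Idx s) ℝ where
  toFun := levi s
  map_one' := by
    simp only [levi, inv_one, Matrix.SpecialLinearGroup.coe_one, Matrix.transpose_one,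
      Matrix.mul_one, hyp_mul_hyp, upper_one]
  map_mul' A B := by
    rw [levi_eq, levi_eq, levi_eq, upper_mul]
    simp only [Matrix.mul_zero, Matrix.zero_mul, add_zero, Matrix.mul_one,
      Matrix.SpecialLinearGroup.coe_mul]
    congr 1
    ext i j
    fin_cases i <;> fin_cases j <;> simp [Matrix.mul_apply, Fin.sum_univ_two] <;> ring

lemma heis_mul (S₀ : Matrix (Fin s) (Fin s) ℤ) (hS : S₀.transpose = S₀)
    (x y x' y' : Fin s → ℝ) (r r' : ℝ) :
    heis S₀ x y r * heis S₀ x' y' r' =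
      heis S₀ (x + x') (y + y') (r + r' + bil S₀ x y') := by
  simp only [heis, upper_mul, Matrix.one_mul, Matrix.mul_one]
  congr 1
  · ext i j
    fin_cases i <;> simp [Matrix.add_vecMul, add_comm]
  · have hb : ∀ v w : Fin s → ℝ, ∑ j, Matrix.vecMul v (S₀.map (Int.cast : ℤ → ℝ)) j * w j =
        bil S₀ v w := by
      intro v w
      rw [bil, Matrix.dotProduct_mulVec]
      rfl
    ext i j
    simp only [Matrix.add_apply, Matrix.mul_apply]
    fin_cases i <;> fin_cases j <;>
      simp [hb, bil_add_left, bil_add_right, bil_comm hS y x',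
        bil_comm hS y' y, bil_comm hS x' x] <;>
      ring
  · ext i j
    fin_cases j <;> simp [add_comm]

lemma heis_zero (S₀ : Matrix (Fin s) (Fin s) ℤ) : heis S₀ 0 0 0 = 1 := by
  rw [← upper_one, heis]
  congr 1
  · ext i j
    fin_cases i <;> simp
  · ext i j
    fin_cases i <;> fin_cases j <;> simp [bil_zero_left]
  · ext i j
    fin_cases j <;> simp

lemma heis_mul_neg (S₀ : Matrix (Fin s) (Fin s) ℤ) (hS : S₀.transpose = S₀)
    (x y : Fin s → ℝ) (r : ℝ) : heis S₀ x y r * heis S₀ (-x) (-y) (bil S₀ x y - r) = 1 := by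
  rw [heis_mul S₀ hS, ← heis_zero S₀]
  simp [bil_neg_right]

/-- SL(2, ℝ) normalizes the Heisenberg group, acting on the row (x, y) by right multiplication. This
commutation rule lets products and inverses be rewritten as {A}{x, y; r}. -/
lemma heis_mul_levi (S₀ : Matrix (Fin s) (Fin s) ℤ) (hS : S₀.transpose = S₀)
    (x y : Fin s → ℝ) (r : ℝ) (A : SL(2, ℝ)) :
    heis S₀ x y r * levi s A = levi s A *
      heis S₀ (A 0 0 • x + A 1 0 • y) (A 0 1 • x + A 1 1 • y)
        (r + A 0 1 * A 1 0 * bil S₀ x y + A 1 0 * A 1 1 / 2 * bil S₀ y y +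
          A 0 0 * A 0 1 / 2 * bil S₀ x x) := by
  have hdet := det_SL2 A
  rw [levi_eq]
  simp only [heis, upper_mul, Matrix.one_mul, Matrix.mul_one, Matrix.mul_zero, Matrix.zero_mul,
    add_zero, zero_add]
  congr 1
  · ext i j
    fin_cases i <;> simp [Matrix.mul_apply, Fin.sum_univ_two, Matrix.add_vecMul,
      Matrix.smul_vecMul]
    · linear_combination (-Matrix.vecMul y (S₀.map (Int.cast : ℤ → ℝ)) j) * hdet
    · linear_combination (-Matrix.vecMul x (S₀.map (Int.cast : ℤ → ℝ)) j) * hdet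
  · ext i j
    fin_cases i <;> fin_cases j <;>
      simp [Matrix.mul_apply, Fin.sum_univ_two, bil_add_left, bil_add_right, bil_smul_left,
        bil_smul_right, bil_comm hS y x]
    · linear_combination (-(A 0 0 * bil S₀ x y + A 1 0 * bil S₀ y y / 2)) * hdet
    · linear_combination (-(A 0 1 * bil S₀ x y + A 1 1 * bil S₀ y y / 2)) * hdet
    · linear_combination (-(A 0 0 * bil S₀ x x / 2)) * hdet
    · linear_combination (-(A 0 1 * bil S₀ x x / 2)) * hdet
  · ext i j
    fin_cases j <;> simp [Matrix.mul_apply, Fin.sum_univ_two, mul_comm]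

lemma exists_levi_mul_heis {S₀ : Matrix (Fin s) (Fin s) ℤ} (hS : S₀.transpose = S₀)
    {g : GL (Idx s) ℝ} (hg : g ∈ GJ S₀) : ∃ (A : SL(2, ℝ)) (x y : Fin s → ℝ) (r : ℝ),
      (g : Matrix (Idx s) (Idx s) ℝ) = levi s A * heis S₀ x y r := by
  have levi_one : levi s 1 = 1 := (leviHom s).map_one
  have levi_mul : ∀ A B, levi s (A * B) = levi s A * levi s B := (leviHom s).map_mul
  induction hg using Subgroup.closure_induction with
  | mem g hg =>
    rcases hg with ⟨A, hA⟩ | ⟨x, y, r, h⟩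
    · exact ⟨A, 0, 0, 0, by rw [hA, heis_zero, mul_one]⟩
    · exact ⟨1, x, y, r, by rw [h, levi_one, one_mul]⟩
  | one => exact ⟨1, 0, 0, 0, by rw [levi_one, heis_zero, mul_one, Units.val_one]⟩
  | mul g h _ _ hg hh =>
    obtain ⟨A, x, y, r, hg⟩ := hg
    obtain ⟨B, x', y', r', hh⟩ := hh
    have e : ((g * h : GL (Idx s) ℝ) : Matrix (Idx s) (Idx s) ℝ) =
        levi s A * heis S₀ x y r * (levi s B * heis S₀ x' y' r') := by
      rw [Units.val_mul, hg, hh]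
    rw [mul_assoc, ← mul_assoc (heis S₀ x y r), heis_mul_levi S₀ hS, mul_assoc, heis_mul S₀ hS,
      ← mul_assoc, ← levi_mul] at e
    exact ⟨_, _, _, _, e⟩
  | inv g _ hg =>
    obtain ⟨A, x, y, r, hg⟩ := hg
    have e : ((g⁻¹ : GL (Idx s) ℝ) : Matrix (Idx s) (Idx s) ℝ) =
        heis S₀ (-x) (-y) (bil S₀ x y - r) * levi s A⁻¹ := by
      refine Units.inv_eq_of_mul_eq_one_right ?_
      rw [hg, mul_assoc, ← mul_assoc (heis S₀ x y r), heis_mul_neg S₀ hS, one_mul, ← levi_mul,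
        mul_inv_cancel, levi_one]
    rw [heis_mul_levi S₀ hS] at e
    exact ⟨_, _, _, _, e⟩

/-- `levi` as a homomorphism into the general linear group. -/
def leviGL (s : ℕ) : SL(2, ℝ) →* GL (Idx s) ℝ := (leviHom s).toHomUnits

lemma coe_leviGL (A : SL(2, ℝ)) : (leviGL s A : Matrix (Idx s) (Idx s) ℝ) = levi s A := rfl

/-- `heis` as an element of the general linear group. -/
def heisGL {S₀ : Matrix (Fin s) (Fin s) ℤ} (hS : S₀.transpose = S₀) (x y : Fin s → ℝ) (r : ℝ) :
    GL (Idx s) ℝ where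
  val := heis S₀ x y r
  inv := heis S₀ (-x) (-y) (bil S₀ x y - r)
  val_inv := heis_mul_neg S₀ hS x y r
  inv_val := mul_eq_one_comm.1 (heis_mul_neg S₀ hS x y r)

section mulVec

variable {R : Type*} [CommRing R] (f : ℝ →+* R)

/-- The coefficient map f is general: invariance of the form under {A} is used over ℝ for
orthogonality and over ℂ for the cone. -/
lemma levi_mulVec (A : SL(2, ℝ)) (v : Idx s → R) :
    ((levi s A).map f).mulVec v =
      Sum.elim ![f (A 0 0) * v (.inl 0) - f (A 0 1) * v (.inl 1),
          -f (A 1 0) * v (.inl 0) + f (A 1 1) * v (.inl 1)]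
        (Sum.elim (fun i => v (.inr (.inl i)))
          ![f (A 0 0) * v (.inr (.inr 0)) + f (A 0 1) * v (.inr (.inr 1)),
            f (A 1 0) * v (.inr (.inr 0)) + f (A 1 1) * v (.inr (.inr 1))]) := by
  rw [levi_eq]
  funext i
  rcases i with i | i | i
  · fin_cases i <;> (simp [upper, Matrix.mulVec, dotProduct, Fintype.sum_sum_type]; try ring)
  · simp [upper, Matrix.mulVec, dotProduct, Fintype.sum_sum_type, Matrix.one_apply]
  · fin_cases i <;> simp [upper, Matrix.mulVec, dotProduct, Fintype.sum_sum_type]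

lemma heis_mulVec (S₀ : Matrix (Fin s) (Fin s) ℤ) (x y : Fin s → ℝ) (r : ℝ) (v : Idx s → R) :
    ((heis S₀ x y r).map f).mulVec v =
      Sum.elim ![v (.inl 0) + bil S₀ (fun i => f (y i)) (fun i => v (.inr (.inl i))) +
            f (bil S₀ x y - r) * v (.inr (.inr 0)) + f (bil S₀ y y / 2) * v (.inr (.inr 1)),
          v (.inl 1) + bil S₀ (fun i => f (x i)) (fun i => v (.inr (.inl i))) +
            f (bil S₀ x x / 2) * v (.inr (.inr 0)) + f r * v (.inr (.inr 1))]
        (Sum.elim (fun i => v (.inr (.inl i)) + f (x i) * v (.inr (.inr 0)) +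
            f (y i) * v (.inr (.inr 1)))
          ![v (.inr (.inr 0)), v (.inr (.inr 1))]) := by
  have hb : ∀ u : Fin s → ℝ, ∑ j, f (Matrix.vecMul u (S₀.map (Int.cast : ℤ → ℝ)) j) *
      v (.inr (.inl j)) = bil S₀ (fun i => f (u i)) fun i => v (.inr (.inl i)) := by
    intro u
    rw [bil, Matrix.dotProduct_mulVec]
    simp [dotProduct, Matrix.vecMul]
  funext i
  rcases i with i | i | i
  · fin_cases i <;>
      simp [heis, upper, Matrix.mulVec, dotProduct, Fintype.sum_sum_type, hb] <;> ring
  · simp [heis, upper, Matrix.mulVec, dotProduct, Fintype.sum_sum_type, Matrix.one_apply]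
    ring
  · fin_cases i <;> simp [heis, upper, Matrix.mulVec, dotProduct, Fintype.sum_sum_type]

lemma bil_levi_mulVec (S₀ : Matrix (Fin s) (Fin s) ℤ) (A : SL(2, ℝ)) (v w : Idx s → R) :
    bil (gramM S₀) (((levi s A).map f).mulVec v) (((levi s A).map f).mulVec w) =
      bil (gramM S₀) v w := by
  have hdet : f (A 0 0) * f (A 1 1) - f (A 0 1) * f (A 1 0) = 1 := by
    rw [← map_mul, ← map_mul, ← map_sub, det_SL2, map_one]
  rw [levi_mulVec, levi_mulVec, bil_gramM, bil_gramM]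
  simp
  linear_combination (-(v (.inl 0) * w (.inr (.inr 1))) - v (.inl 1) * w (.inr (.inr 0)) -
    v (.inr (.inr 0)) * w (.inl 1) - v (.inr (.inr 1)) * w (.inl 0)) * hdet

lemma bil_heis_mulVec {S₀ : Matrix (Fin s) (Fin s) ℤ} (hS : S₀.transpose = S₀)
    (x y : Fin s → ℝ) (r : ℝ) (v w : Idx s → R) :
    bil (gramM S₀) (((heis S₀ x y r).map f).mulVec v) (((heis S₀ x y r).map f).mulVec w) =
      bil (gramM S₀) v w := by
  have hmid : ∀ u : Idx s → R, (fun i => u (.inr (.inl i)) + f (x i) * u (.inr (.inr 0)) +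
      f (y i) * u (.inr (.inr 1))) = (fun i => u (.inr (.inl i))) +
        u (.inr (.inr 0)) • (fun i => f (x i)) + u (.inr (.inr 1)) • fun i => f (y i) := by
    intro u
    ext i
    simp [mul_comm]
  have hhalf : ∀ u : Fin s → ℝ, f (bil S₀ u u / 2) + f (bil S₀ u u / 2) =
      bil S₀ (fun i => f (u i)) fun i => f (u i) := by
    intro u
    rw [← map_add, add_halves, map_bil]
  rw [heis_mulVec, heis_mulVec, bil_gramM, bil_gramM]
  simp only [Sum.elim_inl, Sum.elim_inr, Matrix.cons_val_zero, Matrix.cons_val_one, hmid,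
    bil_add_left, bil_add_right, bil_smul_left, bil_smul_right, ← hhalf, map_sub,
    map_bil S₀ f x y]
  rw [bil_comm hS (fun i => v (.inr (.inl i))) fun i => f (x i),
    bil_comm hS (fun i => v (.inr (.inl i))) fun i => f (y i),
    bil_comm hS (fun i => f (y i)) fun i => f (x i)]
  ring

end mulVec

/-- A real matrix commutes with complex conjugation, so an isometry of the bilinear form also
preserves the Hermitian norm. -/
lemma preservesCone_of_isometry {S₀ : Matrix (Fin s) (Fin s) ℤ}
    (hpos : (S₀.map (Int.cast : ℤ → ℝ)).PosDef) {g : Matrix (Idx s) (Idx s) ℝ}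
    (h1 : ∀ v w : Idx s → ℂ, bil (gramM S₀) ((g.map (Complex.ofReal : ℝ → ℂ)).mulVec v)
      ((g.map (Complex.ofReal : ℝ → ℂ)).mulVec w) = bil (gramM S₀) v w)
    (h2 : ∀ v : Idx s → ℂ, ((g.map (Complex.ofReal : ℝ → ℂ)).mulVec v (.inr (.inr 0)) *
        star ((g.map (Complex.ofReal : ℝ → ℂ)).mulVec v (.inr (.inr 1)))).im =
      (v (.inr (.inr 0)) * star (v (.inr (.inr 1)))).im) : PreservesCone S₀ g := by
  intro v
  have hstar : star ((g.map (Complex.ofReal : ℝ → ℂ)).mulVec v) =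
      (g.map (Complex.ofReal : ℝ → ℂ)).mulVec (star v) := by
    ext i
    simp [Matrix.mulVec, dotProduct]
  rw [mem_coneD_iff hpos, mem_coneD_iff hpos, h2, hstar, h1, h1]

lemma preservesCone_levi {S₀ : Matrix (Fin s) (Fin s) ℤ}
    (hpos : (S₀.map (Int.cast : ℤ → ℝ)).PosDef) (A : SL(2, ℝ)) :
    PreservesCone S₀ (levi s A) := by
  refine preservesCone_of_isometry hpos (bil_levi_mulVec Complex.ofRealHom S₀ A) fun v => ?_
  have h : ((levi s A).map (Complex.ofReal : ℝ → ℂ)).mulVec v = _ :=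
    levi_mulVec Complex.ofRealHom A v
  have hdet := det_SL2 A
  rw [h]
  simp
  linear_combination ((v (.inr (.inr 0))).im * (v (.inr (.inr 1))).re -
    (v (.inr (.inr 0))).re * (v (.inr (.inr 1))).im) * hdet

lemma preservesCone_heis {S₀ : Matrix (Fin s) (Fin s) ℤ}
    (hpos : (S₀.map (Int.cast : ℤ → ℝ)).PosDef) (x y : Fin s → ℝ) (r : ℝ) :
    PreservesCone S₀ (heis S₀ x y r) := by
  refine preservesCone_of_isometry hpos
    (bil_heis_mulVec Complex.ofRealHom (transpose_eq_of_posDef hpos) x y r) fun v => ?_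
  have h : ((heis S₀ x y r).map (Complex.ofReal : ℝ → ℂ)).mulVec v = _ :=
    heis_mulVec Complex.ofRealHom S₀ x y r v
  rw [h]
  simp

lemma transpose_mul_gramM_mul {S₀ : Matrix (Fin s) (Fin s) ℤ} {g : Matrix (Idx s) (Idx s) ℝ}
    (h : ∀ v w : Idx s → ℝ, bil (gramM S₀) (g.mulVec v) (g.mulVec w) = bil (gramM S₀) v w) :
    g.transpose * (gramM S₀).map (Int.cast : ℤ → ℝ) * g =
      (gramM S₀).map (Int.cast : ℤ → ℝ) := by
  ext i j
  have hij := h (Pi.single i 1) (Pi.single j 1)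
  rw [bil_single_single, bil, Matrix.mulVec_mulVec, Matrix.dotProduct_mulVec,
    ← Matrix.vecMul_transpose, Matrix.vecMul_vecMul] at hij
  rw [mul_assoc]
  simpa using hij

lemma leviGL_mem_ΓJ {S₀ : Matrix (Fin s) (Fin s) ℤ}
    (hpos : (S₀.map (Int.cast : ℤ → ℝ)).PosDef) {A : SL(2, ℝ)}
    (hA : ∀ i j, ∃ a : ℤ, A i j = a) : leviGL s A ∈ ΓJ S₀ := by
  refine ⟨⟨⟨?_, preservesCone_levi hpos A⟩, fun i j => ?_⟩,
    Subgroup.subset_closure (Or.inl ⟨A, rfl⟩)⟩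
  · rw [coe_leviGL]
    refine transpose_mul_gramM_mul fun v w => ?_
    simpa using bil_levi_mulVec (RingHom.id ℝ) S₀ A v w
  · rw [coe_leviGL, levi_eq]
    have hz : ∃ a : ℤ, (0 : ℝ) = a := ⟨0, by simp⟩
    have hn : ∀ {t : ℝ}, (∃ a : ℤ, t = a) → ∃ a : ℤ, -t = a := by
      rintro t ⟨a, rfl⟩
      exact ⟨-a, by simp⟩
    rcases i with i | i | i <;> rcases j with j | j | j
    · fin_cases i <;> fin_cases j
      · exact hA 0 0
      · exact hn (hA 0 1)
      · exact hn (hA 1 0)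
      · exact hA 1 1
    · exact hz
    · exact hz
    · exact hz
    · refine ⟨(1 : Matrix (Fin s) (Fin s) ℤ) i j, ?_⟩
      simp [upper, Matrix.one_apply]
    · exact hz
    · exact hz
    · exact hz
    · exact hA i j

/-- The integral elements of the Jacobi group. -/
lemma exists_int_levi_mul_heis {S₀ : Matrix (Fin s) (Fin s) ℤ} (hS : S₀.transpose = S₀)
    {g : GL (Idx s) ℝ} (hg : g ∈ ΓJ S₀) : ∃ (A : SL(2, ℤ)) (x y : Fin s → ℤ) (r : ℤ),
      g = leviGL s (Matrix.SpecialLinearGroup.map (Int.castRingHom ℝ) A) *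
        heisGL hS (fun i => (x i : ℝ)) (fun i => (y i : ℝ)) (r : ℝ) := by
  obtain ⟨⟨-, hint⟩, hJ⟩ := hg
  obtain ⟨A, x, y, r, h⟩ := exists_levi_mul_heis hS hJ
  have hup := h
  rw [levi_eq, heis, upper_mul] at hup
  have hAint : ∀ i j, ∃ a : ℤ, A i j = a := by
    intro i j
    obtain ⟨a, ha⟩ := hint (.inr (.inr i)) (.inr (.inr j))
    refine ⟨a, ?_⟩
    rw [← ha, hup]
    simp [upper]
  choose A' hA' using hAint
  have hdet : (Matrix.of A').det = 1 := by
    have := det_SL2 A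
    rw [hA', hA', hA', hA'] at this
    rw [Matrix.det_fin_two]
    exact_mod_cast this
  set A₁ : SL(2, ℤ) := ⟨Matrix.of A', hdet⟩ with hA₁
  have hA : A = Matrix.SpecialLinearGroup.map (Int.castRingHom ℝ) A₁ := by
    ext i j
    exact hA' i j
  -- A is the lower right block of g, hence integral. Dividing it out leaves an integral Heisenberg
  -- matrix, among whose entries are x, y and r.
  have hh : heis S₀ x y r = levi s A⁻¹ * (g : Matrix (Idx s) (Idx s) ℝ) := by
    rw [h, ← mul_assoc]
    change _ = leviHom s A⁻¹ * leviHom s A * _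
    rw [← map_mul, inv_mul_cancel, map_one, one_mul]
  have hX : ∀ i, (∃ a : ℤ, x i = a) ∧ ∃ a : ℤ, y i = a := by
    intro i
    have hi : ∀ j, ∃ a : ℤ, (Matrix.of fun i => ![x i, y i]) i j = (a : ℝ) := by
      intro j
      obtain ⟨a, ha⟩ := hint (.inr (.inl i)) (.inr (.inr j))
      refine ⟨a, ?_⟩
      rw [← ha]
      have : heis S₀ x y r (.inr (.inl i)) (.inr (.inr j)) =
        (Matrix.of fun i => ![x i, y i]) i j := rfl
      rw [← this, hh, levi_eq, Matrix.mul_apply]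
      simp [upper, Fintype.sum_sum_type, Matrix.one_apply]
    exact ⟨hi 0, hi 1⟩
  have hr : ∃ a : ℤ, r = a := by
    have h1 : heis S₀ x y r (.inl 1) (.inr (.inr 1)) = r := rfl
    obtain ⟨a, ha⟩ := hint (.inl 0) (.inr (.inr 1))
    obtain ⟨b, hb⟩ := hint (.inl 1) (.inr (.inr 1))
    refine ⟨A' 1 0 * a + A' 0 0 * b, ?_⟩
    rw [← h1, hh, levi_eq, Matrix.mul_apply]
    simp [upper, Fintype.sum_sum_type, Matrix.SpecialLinearGroup.coe_inv,
      Matrix.adjugate_fin_two, ha, hb, hA']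
  choose x' hx' using fun i => (hX i).1
  choose y' hy' using fun i => (hX i).2
  obtain ⟨r', hr'⟩ := hr
  refine ⟨A₁, x', y', r', Units.ext ?_⟩
  rw [Units.val_mul, coe_leviGL, ← hA, h, funext hx', funext hy', hr']
  rfl

/-! ### The action of the generators -/

lemma J_levi (S₀ : Matrix (Fin s) (Fin s) ℤ) (A : SL(2, ℝ)) (Z : Pt s) :
    J S₀ (levi s A) Z = A 1 0 * Z.τ + A 1 1 := by
  have h : ((levi s A).map (Complex.ofReal : ℝ → ℂ)).mulVec (borelEmb S₀ Z) = _ :=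
    levi_mulVec Complex.ofRealHom A _
  rw [J, actBorel, h]
  simp [borelEmb]

lemma act_levi (S₀ : Matrix (Fin s) (Fin s) ℤ) (A : SL(2, ℝ)) (Z : Pt s) :
    act S₀ (levi s A) Z =
      ⟨(-A 1 0 * ((bil S₀ Z.z Z.z - 2 * Z.ω * Z.τ) / 2) + A 1 1 * Z.ω) / (A 1 0 * Z.τ + A 1 1),
        (A 1 0 * Z.τ + A 1 1 : ℂ)⁻¹ • Z.z, (A 0 0 * Z.τ + A 0 1) / (A 1 0 * Z.τ + A 1 1)⟩ := by
  have h : ((levi s A).map (Complex.ofReal : ℝ → ℂ)).mulVec (borelEmb S₀ Z) = _ :=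
    levi_mulVec Complex.ofRealHom A _
  rw [act, J_levi, actBorel, h]
  congr 1
  · ext i
    simp [borelEmb, div_eq_inv_mul]
  · simp [borelEmb]

lemma J_heis (S₀ : Matrix (Fin s) (Fin s) ℤ) (x y : Fin s → ℝ) (r : ℝ) (Z : Pt s) :
    J S₀ (heis S₀ x y r) Z = 1 := by
  have h : ((heis S₀ x y r).map (Complex.ofReal : ℝ → ℂ)).mulVec (borelEmb S₀ Z) = _ :=
    heis_mulVec Complex.ofRealHom S₀ x y r _
  rw [J, actBorel, h]
  simp [borelEmb]

lemma act_heis (S₀ : Matrix (Fin s) (Fin s) ℤ) (x y : Fin s → ℝ) (r : ℝ) (Z : Pt s) :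
    act S₀ (heis S₀ x y r) Z =
      ⟨Z.ω + bil S₀ (fun i => (x i : ℂ)) Z.z + ((bil S₀ x x : ℝ) : ℂ) / 2 * Z.τ + r,
        Z.z + Z.τ • (fun i => (x i : ℂ)) + fun i => (y i : ℂ), Z.τ⟩ := by
  have h : ((heis S₀ x y r).map (Complex.ofReal : ℝ → ℂ)).mulVec (borelEmb S₀ Z) = _ :=
    heis_mulVec Complex.ofRealHom S₀ x y r _
  rw [act, J_heis, actBorel, h]
  congr 1
  · simp [borelEmb]
  · ext i
    simp [borelEmb, mul_comm]
  · simp [borelEmb]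

/-- The function `e^{2πiω} φ(τ, z)` on the tube domain. -/
def lift (φ : ℂ × (Fin s → ℂ) → ℂ) (Z : Pt s) : ℂ :=
  Complex.exp (2 * Real.pi * Complex.I * Z.ω) * φ (Z.τ, Z.z)

/-- Moving e^{2πiω} into the function reduces the index 1 action to the pure weight k action, for
which `J_mul` makes the invariant elements a group. -/
lemma slash_eq_iff (S₀ : Matrix (Fin s) (Fin s) ℤ) (k : ℕ) (φ : ℂ × (Fin s → ℂ) → ℂ)
    (g : Matrix (Idx s) (Idx s) ℝ) (Z : Pt s) (hJ : J S₀ g Z ≠ 0) :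
    slash S₀ k 1 φ g Z = φ (Z.τ, Z.z) ↔ lift φ (act S₀ g Z) = J S₀ g Z ^ k * lift φ Z := by
  have h1 := Complex.exp_ne_zero (2 * Real.pi * Complex.I * (act S₀ g Z).ω)
  have h2 := Complex.exp_ne_zero (2 * Real.pi * Complex.I * Z.ω)
  have h3 := pow_ne_zero k hJ
  rw [slash, Jkm, lift, lift]
  simp only [Nat.cast_one, mul_one, Complex.exp_neg]
  constructor
  · intro h
    rw [← h]
    field_simp
  · intro h
    rw [inv_mul_eq_iff_eq_mul₀ (by positivity)]
    field_simp
    linear_combination h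

/-- The element of order four that generates `SL(2, ℤ)` with the translation. -/
def invSL : SL(2, ℝ) := Matrix.SpecialLinearGroup.map (Int.castRingHom ℝ) ModularGroup.S

lemma invSL_apply : invSL 0 0 = 0 ∧ invSL 0 1 = -1 ∧ invSL 1 0 = 1 ∧ invSL 1 1 = 0 := by
  have h : ∀ i j, invSL i j = ((ModularGroup.S i j : ℤ) : ℝ) := fun _ _ => rfl
  simp [h, ModularGroup.S]

lemma J_invSL (S₀ : Matrix (Fin s) (Fin s) ℤ) (Z : Pt s) :
    J S₀ (levi s invSL) Z = Z.τ := by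
  rw [J_levi]
  simp [invSL_apply]

lemma act_invSL (S₀ : Matrix (Fin s) (Fin s) ℤ) {Z : Pt s} (hZ : Z.τ ≠ 0) :
    act S₀ (levi s invSL) Z =
      ⟨Z.ω - bil S₀ Z.z Z.z / (2 * Z.τ), Z.τ⁻¹ • Z.z, -1 / Z.τ⟩ := by
  rw [act_levi]
  simp [invSL_apply]
  field_simp
  ring

lemma lift_invSL_iff (S₀ : Matrix (Fin s) (Fin s) ℤ) (k : ℕ) (φ : ℂ × (Fin s → ℂ) → ℂ)
    {Z : Pt s} (hZ : Z.τ ≠ 0) :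
    lift φ (act S₀ (levi s invSL) Z) = J S₀ (levi s invSL) Z ^ k * lift φ Z ↔
      φ (-1 / Z.τ, Z.τ⁻¹ • Z.z) =
        Z.τ ^ k * Complex.exp (Real.pi * Complex.I * bil S₀ Z.z Z.z / Z.τ) * φ (Z.τ, Z.z) := by
  rw [act_invSL S₀ hZ, J_invSL, lift, lift]
  have h : (2 * Real.pi * Complex.I * (Z.ω - bil S₀ Z.z Z.z / (2 * Z.τ)) : ℂ) =
      2 * Real.pi * Complex.I * Z.ω - Real.pi * Complex.I * bil S₀ Z.z Z.z / Z.τ := by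
    field_simp
  have h1 := Complex.exp_ne_zero (2 * Real.pi * Complex.I * Z.ω)
  have h2 := Complex.exp_ne_zero (Real.pi * Complex.I * bil S₀ Z.z Z.z / Z.τ)
  rw [h, Complex.exp_sub, div_mul_eq_mul_div, div_eq_iff h2]
  constructor
  · intro h
    apply mul_left_cancel₀ h1
    linear_combination h
  · intro h
    rw [h]
    ring

lemma exists_mem_tube (S₀ : Matrix (Fin s) (Fin s) ℤ) {τ : ℂ} (hτ : 0 < τ.im)
    (z : Fin s → ℂ) : ∃ ω : ℂ, (⟨ω, z, τ⟩ : Pt s) ∈ tube S₀ := by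
  set q := bil S₀ (fun i => (z i).im) (fun i => (z i).im)
  -- With this ω, 2 Im ω Im τ = 2(|q| + 1), which exceeds q.
  refine ⟨((|q| + 1) / τ.im : ℝ) * Complex.I, ?_, hτ, ?_⟩
  · rw [Complex.im_ofReal_mul, Complex.I_im]
    positivity
  · change q - 2 * _ * τ.im < 0
    rw [Complex.im_ofReal_mul, Complex.I_im, mul_one]
    have : 2 * ((|q| + 1) / τ.im) * τ.im = 2 * (|q| + 1) := by field_simp
    rw [this]
    have := le_abs_self q
    have := abs_nonneg q
    linarith

/-! ### Singular forms force unimodularity -/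

section singular

variable {S₀ : Matrix (Fin s) (Fin s) ℤ} {k : ℕ} {φ : ℂ × (Fin s → ℂ) → ℂ}

lemma IsJacobiForm.apply_neg_inv (hpos : (S₀.map (Int.cast : ℤ → ℝ)).PosDef)
    (hφ : IsJacobiForm S₀ k 1 φ) {τ : ℂ} (hτ : 0 < τ.im) (z : Fin s → ℂ) :
    φ (-1 / τ, τ⁻¹ • z) =
      τ ^ k * Complex.exp (Real.pi * Complex.I * bil S₀ z z / τ) * φ (τ, z) := by
  obtain ⟨ω, hZ⟩ := exists_mem_tube S₀ hτ z
  have hτ0 : τ ≠ 0 := by rintro rfl; simp at hτ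
  have hmem : leviGL s invSL ∈ ΓJ S₀ :=
    leviGL_mem_ΓJ hpos fun i j => ⟨ModularGroup.S i j, rfl⟩
  have h := hφ.2.1 _ hmem _ hZ
  rw [coe_leviGL, slash_eq_iff _ _ _ _ _ (by rw [J_invSL]; exact hτ0),
    lift_invSL_iff _ _ _ (by exact hτ0)] at h
  exact h

lemma IsSingularJacobiForm.periodic (hS : S₀.transpose = S₀)
    (hmax : IsMaximalEven (gramM S₀)) (hφ : IsSingularJacobiForm S₀ k 1 φ) {μ : Fin s → ℚ}
    (hμ : μ ∈ dualLattice S₀) {τ : ℂ} (hτ : 0 < τ.im) (z : Fin s → ℂ) :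
    φ (τ, z + fun i => (μ i : ℂ)) = φ (τ, z) := by
  obtain ⟨-, c, hc, hsing⟩ := hφ
  refine (hc (τ, z + fun i => (μ i : ℂ)) hτ).unique ?_
  refine (hc (τ, z) hτ).congr_fun ?_
  rintro ⟨n, l⟩
  by_cases h0 : c n l = 0
  · simp [h0]
  have h1 := hsing n l h0
  -- Singularity in index 1 reads S₀[ℓ] = 2n, so ℓ has even norm and lies in L₀. It then pairs
  -- integrally with the dual vector μ.
  have hint := integral_of_mem_dual hS hmax l.2 ⟨n, by push_cast at h1; linarith⟩
  choose a ha using hint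
  obtain ⟨b, hb⟩ := hμ a
  have hb' : bil S₀ (fun i => ((l : Fin s → ℚ) i : ℂ)) (fun i => (μ i : ℂ)) = (b : ℂ) := by
    rw [bil_ratCast, bil_comm hS, funext ha, hb]
    simp
  congr 1
  simp only [bil_add_right, hb']
  rw [Complex.exp_eq_exp_iff_exists_int]
  exact ⟨b, by ring⟩

/-- Invariance under μ at -1/τ becomes quasi-periodicity under τμ at τ. Comparing its factors at z
and z + ν, where φ takes the same value, isolates exp(2πi ᵗμS₀ν) = 1. -/
lemma IsSingularJacobiForm.exists_int_bil (hpos : (S₀.map (Int.cast : ℤ → ℝ)).PosDef)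
    (hmax : IsMaximalEven (gramM S₀)) (hφ : IsSingularJacobiForm S₀ k 1 φ)
    {p : ℂ × (Fin s → ℂ)} (hp : p ∈ dom s) (hp0 : φ p ≠ 0) {μ ν : Fin s → ℚ}
    (hμ : μ ∈ dualLattice S₀) (hν : ν ∈ dualLattice S₀) : ∃ a : ℤ, bil S₀ μ ν = a := by
  have hS := transpose_eq_of_posDef hpos
  obtain ⟨τ, z⟩ := p
  have hτ : 0 < τ.im := hp
  have hτ0 : τ ≠ 0 := by rintro rfl; simp at hτ
  have hτ' : 0 < (-1 / τ).im := by
    rw [neg_div, one_div, Complex.neg_im, Complex.inv_im, neg_div, neg_neg]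
    exact div_pos hτ (Complex.normSq_pos.2 hτ0)
  set m : Fin s → ℂ := fun i => (μ i : ℂ) with hm
  set v : Fin s → ℂ := fun i => (ν i : ℂ) with hv
  have key : ∀ z : Fin s → ℂ,
      Complex.exp (Real.pi * Complex.I * bil S₀ (z + τ • m) (z + τ • m) / τ) * φ (τ, z + τ • m) =
        Complex.exp (Real.pi * Complex.I * bil S₀ z z / τ) * φ (τ, z) := by
    intro z
    have h1 := hφ.1.apply_neg_inv hpos hτ z
    have h2 := hφ.1.apply_neg_inv hpos hτ (z + τ • m)
    rw [smul_add, smul_smul, inv_mul_cancel₀ hτ0, one_smul, hφ.periodic hS hmax hμ hτ', h1] at h2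
    apply mul_left_cancel₀ (pow_ne_zero k hτ0)
    linear_combination -h2
  have h1 := key z
  have h2 := key (z + v)
  rw [hφ.periodic hS hmax hν hτ, add_right_comm, hφ.periodic hS hmax hν hτ] at h2
  set w := z + τ • m with hw
  have h3 : Complex.exp (Real.pi * Complex.I * bil S₀ (w + v) (w + v) / τ) *
      Complex.exp (Real.pi * Complex.I * bil S₀ z z / τ) =
      Complex.exp (Real.pi * Complex.I * bil S₀ w w / τ) *
      Complex.exp (Real.pi * Complex.I * bil S₀ (z + v) (z + v) / τ) := by
    apply mul_right_cancel₀ hp0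
    linear_combination Complex.exp (Real.pi * Complex.I * bil S₀ w w / τ) * h2 -
      Complex.exp (Real.pi * Complex.I * bil S₀ (w + v) (w + v) / τ) * h1
  rw [← Complex.exp_add, ← Complex.exp_add, Complex.exp_eq_exp_iff_exists_int] at h3
  obtain ⟨n, hn⟩ := h3
  refine ⟨n, ?_⟩
  have h4 : bil S₀ m v = (n : ℂ) := by
    have hpi := Complex.ofReal_ne_zero.2 Real.pi_ne_zero
    simp only [hw, bil_add_left, bil_add_right, bil_smul_left, bil_smul_right,
      bil_comm hS v, bil_comm hS m z] at hn
    have h5 : 2 * Real.pi * Complex.I * (bil S₀ m v - n) = 0 := by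
      field_simp at hn
      apply mul_left_cancel₀ hτ0
      linear_combination Real.pi * Complex.I * hn
    have h6 : (2 * Real.pi * Complex.I : ℂ) ≠ 0 := Complex.two_pi_I_ne_zero
    exact sub_eq_zero.1 ((mul_eq_zero.1 h5).resolve_left h6)
  rw [hm, hv, bil_ratCast] at h4
  exact_mod_cast h4

/-- The columns of S₀⁻¹ are dual vectors, and their Gram matrix is S₀⁻¹ itself. -/
lemma isUnimodular_of_dual (hpos : (S₀.map (Int.cast : ℤ → ℝ)).PosDef)
    (h : ∀ μ ∈ dualLattice S₀, ∀ ν ∈ dualLattice S₀, ∃ a : ℤ, bil S₀ μ ν = a) :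
    IsUnimodular (gramM S₀) := by
  have hS := transpose_eq_of_posDef hpos
  set Q : Matrix (Fin s) (Fin s) ℚ := S₀.map (Int.cast : ℤ → ℚ) with hQ
  have hdet : IsUnit Q.det := by
    rw [isUnit_iff_ne_zero]
    intro h0
    have h1 : Q.det = (S₀.det : ℚ) := ((Int.castRingHom ℚ).map_det S₀).symm
    have h2 : (S₀.map (Int.cast : ℤ → ℝ)).det = (S₀.det : ℝ) :=
      ((Int.castRingHom ℝ).map_det S₀).symm
    rw [h1, Int.cast_eq_zero] at h0
    rw [h0, Int.cast_zero] at h2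
    exact hpos.det_pos.ne' h2
  have hinv : ∀ j, Q.mulVec (Q⁻¹.mulVec (Pi.single j 1)) = Pi.single j 1 := by
    intro j
    rw [Matrix.mulVec_mulVec, Matrix.mul_nonsing_inv _ hdet, Matrix.one_mulVec]
  have hmem : ∀ j, Q⁻¹.mulVec (Pi.single j 1) ∈ dualLattice S₀ := by
    intro j α
    refine ⟨α j, ?_⟩
    rw [bil_comm hS, bil, ← hQ, hinv]
    simp
  have hint : ∀ i j, ∃ a : ℤ, Q⁻¹ i j = a := by
    intro i j
    obtain ⟨a, ha⟩ := h _ (hmem j) _ (hmem i)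
    refine ⟨a, ?_⟩
    rw [← ha, bil, ← hQ, hinv]
    simp
  choose T hT using hint
  refine isUnimodular_gramM_of_mul_eq_one (T := Matrix.of T) ?_
  have hcast : Q * (Matrix.of T).map (Int.cast : ℤ → ℚ) = 1 := by
    have : (Matrix.of T).map (Int.cast : ℤ → ℚ) = Q⁻¹ := by
      ext i j
      simp [hT]
    rw [this, Matrix.mul_nonsing_inv _ hdet]
  ext i j
  have := congrFun (congrFun hcast i) j
  simp only [Matrix.mul_apply, hQ, Matrix.map_apply, Matrix.of_apply, Matrix.one_apply] at this ⊢
  exact_mod_cast this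

end singular

/-! ### The theta function is a singular Jacobi form -/

section theta

variable {S₀ : Matrix (Fin s) (Fin s) ℤ}

lemma thetaArg_intCast (n : Fin s → ℤ) (p : ℂ × (Fin s → ℂ)) :
    thetaArg S₀ (fun i => (n i : ℝ)) p = 2 * Real.pi * Complex.I *
      (((bil S₀ n n : ℤ) : ℂ) / 2 * p.1 + bil S₀ (fun i => (n i : ℂ)) p.2) := by
  rw [thetaArg_apply, bil_intCast]
  simp

lemma theta_add_one (heven : ∀ n : Fin s → ℤ, ∃ a : ℤ, bil S₀ n n = 2 * a) (τ : ℂ)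
    (z : Fin s → ℂ) : theta S₀ (τ + 1, z) = theta S₀ (τ, z) := by
  refine tsum_congr fun n => ?_
  obtain ⟨a, ha⟩ := heven n
  rw [thetaArg_intCast, thetaArg_intCast, Complex.exp_eq_exp_iff_exists_int, ha]
  refine ⟨a, ?_⟩
  push_cast
  ring

lemma theta_add_int (hS : S₀.transpose = S₀) (x y : Fin s → ℤ) (τ : ℂ) (z : Fin s → ℂ) :
    theta S₀ (τ, z + τ • (fun i => (x i : ℂ)) + fun i => (y i : ℂ)) =
      Complex.exp (-(2 * Real.pi * Complex.I *
        (bil S₀ (fun i => (x i : ℂ)) z + ((bil S₀ x x : ℤ) : ℂ) / 2 * τ))) * theta S₀ (τ, z) := by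
  rw [theta, theta, ← tsum_mul_left, ← (Equiv.addRight x).tsum_eq fun n : Fin s → ℤ =>
    Complex.exp (-(2 * Real.pi * Complex.I *
        (bil S₀ (fun i => (x i : ℂ)) z + ((bil S₀ x x : ℤ) : ℂ) / 2 * τ))) *
      Complex.exp (thetaArg S₀ (fun i => (n i : ℝ)) (τ, z))]
  refine tsum_congr fun n => ?_
  rw [← Complex.exp_add, thetaArg_intCast, thetaArg_intCast, Complex.exp_eq_exp_iff_exists_int]
  -- After reindexing n ↦ n + x the square completes, and the exponents differ by 2πi ᵗnS₀y.
  refine ⟨bil S₀ n y, ?_⟩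
  have hadd : (fun i => ((Equiv.addRight x n i : ℤ) : ℂ)) =
      (fun i => (n i : ℂ)) + fun i => (x i : ℂ) := by
    ext i; simp
  rw [hadd, Equiv.coe_addRight]
  simp only [bil_add_left, bil_add_right, bil_smul_right, bil_intCast, bil_comm hS x n]
  push_cast
  ring

/-- At (i, 0) every term of the series is a positive real number. -/
lemma theta_I_ne_zero (hpos : (S₀.map (Int.cast : ℤ → ℝ)).PosDef) :
    theta S₀ (Complex.I, 0) ≠ 0 := by
  have hterm : ∀ n : Fin s → ℤ, Complex.exp (thetaArg S₀ (fun i => (n i : ℝ)) (Complex.I, 0)) =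
      ((Real.exp (-(Real.pi * (bil S₀ n n : ℤ))) : ℝ) : ℂ) := by
    intro n
    rw [thetaArg_intCast, Complex.ofReal_exp, bil_zero_right]
    congr 1
    push_cast
    linear_combination (Real.pi * (bil S₀ n n : ℤ) : ℂ) * Complex.I_mul_I
  have hsum := summable_theta hpos (p := (Complex.I, 0)) (by simp [dom])
  rw [theta, tsum_congr hterm, ← Complex.ofReal_tsum, Complex.ofReal_ne_zero]
  rw [summable_congr hterm, Complex.summable_ofReal] at hsum
  exact (hsum.tsum_pos (fun n => (Real.exp_pos _).le) 0 (Real.exp_pos _)).ne'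

variable {k : ℕ}

/-- The map τ ↦ -1/(τ + 1) has order three. Three steps from i return to i, and the factors -i(τ +
1) along the orbit multiply to -i. Since theta does not vanish at (i, 0), this gives (-i)^k = 1,
that is, 8 divides s. -/
lemma neg_I_pow_eq_one (hpos : (S₀.map (Int.cast : ℤ → ℝ)).PosDef) (hu : IsUnit S₀)
    (hk : s = 2 * k) (heven : ∀ n : Fin s → ℤ, ∃ a : ℤ, bil S₀ n n = 2 * a) :
    (-Complex.I) ^ k = 1 := by
  have hstep : ∀ τ : ℂ, 0 < τ.im →
      theta S₀ (-1 / (τ + 1), 0) = (-Complex.I * (τ + 1)) ^ k * theta S₀ (τ, 0) := by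
    intro τ hτ
    have h := theta_neg_inv hpos hu hk (τ := τ + 1) (by simpa using hτ) 0
    rw [theta_add_one heven, smul_zero, bil_zero_right] at h
    simpa using h
  have him : ∀ τ : ℂ, 0 < τ.im → 0 < (-1 / (τ + 1)).im ∧ τ + 1 ≠ 0 := by
    intro τ hτ
    have h1 : 0 < (τ + 1).im := by simpa using hτ
    have h0 : τ + 1 ≠ 0 := by intro h; simp [h] at h1
    rw [neg_div, one_div, Complex.neg_im, Complex.inv_im, neg_div, neg_neg]
    exact ⟨div_pos h1 (Complex.normSq_pos.2 h0), h0⟩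
  have hI : 0 < Complex.I.im := by simp
  obtain ⟨h1, h1'⟩ := him _ hI
  obtain ⟨h2, h2'⟩ := him _ h1
  have e2 : -1 / (Complex.I + 1) + 1 = Complex.I / (Complex.I + 1) := by field_simp; ring
  have e3 : -1 / (-1 / (Complex.I + 1) + 1) + 1 = Complex.I := by
    rw [e2]
    have := Complex.I_ne_zero
    field_simp
    linear_combination -Complex.I_mul_I
  have e4 : -1 / (-1 / (-1 / (Complex.I + 1) + 1) + 1) = Complex.I := by
    rw [e3]
    have := Complex.I_ne_zero
    field_simp
    linear_combination -Complex.I_mul_I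
  have key := hstep _ h2
  rw [e4, e3, hstep _ h1, hstep _ hI, e2, ← mul_assoc, ← mul_assoc, ← mul_pow, ← mul_pow] at key
  have e5 : -Complex.I * Complex.I * (-Complex.I * (Complex.I / (Complex.I + 1))) *
      (-Complex.I * (Complex.I + 1)) = -Complex.I := by
    have hq : Complex.I / (Complex.I + 1) * (Complex.I + 1) = Complex.I :=
      div_mul_cancel₀ _ (by intro h; simp [h] at h1)
    linear_combination (-Complex.I ^ 4) * hq +
      (-Complex.I * (Complex.I ^ 2 - 1)) * Complex.I_mul_I
  rw [e5] at key
  have h0 := theta_I_ne_zero hpos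
  apply mul_right_cancel₀ h0
  rw [← key, one_mul]

lemma theta_neg_inv' (hpos : (S₀.map (Int.cast : ℤ → ℝ)).PosDef) (hu : IsUnit S₀)
    (hk : s = 2 * k) (heven : ∀ n : Fin s → ℤ, ∃ a : ℤ, bil S₀ n n = 2 * a)
    {τ : ℂ} (hτ : 0 < τ.im) (z : Fin s → ℂ) :
    theta S₀ (-1 / τ, τ⁻¹ • z) =
      τ ^ k * Complex.exp (Real.pi * Complex.I * bil S₀ z z / τ) * theta S₀ (τ, z) := by
  rw [theta_neg_inv hpos hu hk hτ, mul_pow, neg_I_pow_eq_one hpos hu hk heven, one_mul]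

lemma ΓJ_le_stabilizer (hpos : (S₀.map (Int.cast : ℤ → ℝ)).PosDef) (hu : IsUnit S₀)
    (hk : s = 2 * k) (heven : ∀ n : Fin s → ℤ, ∃ a : ℤ, bil S₀ n n = 2 * a)
    {g : GL (Idx s) ℝ} (hg : g ∈ ΓJ S₀) : g ∈ stabilizer S₀ k (lift (theta S₀)) := by
  have hS := transpose_eq_of_posDef hpos
  obtain ⟨A, x, y, r, rfl⟩ := exists_int_levi_mul_heis hS hg
  refine mul_mem ?_ ?_
  · set f : SL(2, ℤ) →* GL (Idx s) ℝ :=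
      (leviGL s).comp (Matrix.SpecialLinearGroup.map (Int.castRingHom ℝ)) with hf
    -- The preimage of the stabilizer in SL(2, ℤ) is a subgroup, so it is enough that it contains S
    -- and T.
    suffices h : (stabilizer S₀ k (lift (theta S₀))).comap f = ⊤ by
      have hA : A ∈ (stabilizer S₀ k (lift (theta S₀))).comap f := h ▸ Subgroup.mem_top A
      exact hA
    rw [eq_top_iff, ← SpecialLinearGroup.SL2Z_generators, Subgroup.closure_le]
    rintro B (rfl | rfl)
    · refine ⟨preservesCone_levi hpos _, fun Z hZ => ?_⟩
      have hτ0 : Z.τ ≠ 0 := by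
        intro h
        have := hZ.2.1
        simp [h] at this
      exact (lift_invSL_iff S₀ k _ hτ0).2 (theta_neg_inv' hpos hu hk heven hZ.2.1 _)
    · refine ⟨preservesCone_levi hpos _, fun Z hZ => ?_⟩
      change lift (theta S₀) (act S₀ (levi s _) Z) = J S₀ (levi s _) Z ^ k * _
      have hT : ∀ i j, Matrix.SpecialLinearGroup.map (Int.castRingHom ℝ) ModularGroup.T i j =
        ((ModularGroup.T i j : ℤ) : ℝ) := fun _ _ => rfl
      rw [act_levi, J_levi]
      simp only [hT]
      simp [lift, ModularGroup.T, theta_add_one heven]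
  · refine ⟨preservesCone_heis hpos _ _ _, fun Z hZ => ?_⟩
    change lift (theta S₀) (act S₀ (heis S₀ _ _ _) Z) = J S₀ (heis S₀ _ _ _) Z ^ k * _
    rw [act_heis, J_heis, one_pow, one_mul, lift, lift]
    simp only [Complex.ofReal_intCast]
    rw [theta_add_int hS, ← mul_assoc, ← Complex.exp_add]
    congr 1
    rw [Complex.exp_eq_exp_iff_exists_int, bil_intCast]
    refine ⟨r, ?_⟩
    push_cast
    ring

/-- The coefficients are the indicator function of the pairs (½S₀[n], n) with n in ℤ^s; evenness
makes the first entry an integer. -/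
lemma exists_hasFourier_theta (hpos : (S₀.map (Int.cast : ℤ → ℝ)).PosDef)
    (heven : ∀ n : Fin s → ℤ, ∃ a : ℤ, bil S₀ n n = 2 * a) :
    ∃ c : ℤ → dualLattice S₀ → ℂ, HasFourier S₀ (theta S₀) c ∧
      ∀ n l, c n l ≠ 0 →
        2 * (n : ℚ) * (1 : ℕ) - bil S₀ (l : Fin s → ℚ) (l : Fin s → ℚ) = 0 := by
  classical
  choose q hq using heven
  set ι : (Fin s → ℤ) → ℤ × dualLattice S₀ := fun n =>
    (q n, ⟨fun i => (n i : ℚ), fun α => ⟨bil S₀ n α, bil_intCast S₀ n α⟩⟩) with hι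
  have hinj : Function.Injective ι := by
    intro m n hmn
    have h := congrArg (fun p => (p.2 : Fin s → ℚ)) hmn
    funext i
    have := congrFun h i
    simpa [hι] using this
  refine ⟨fun n l => if (n, l) ∈ Set.range ι then 1 else 0, fun p hp => ?_, fun n l h => ?_⟩
  · rw [← hinj.hasSum_iff (fun x hx => by simp only [Prod.mk.eta, if_neg hx, zero_mul])]
    refine (summable_theta hpos hp).hasSum.congr_fun fun n => ?_
    simp only [Function.comp_apply, Prod.mk.eta, Set.mem_range_self, if_true, one_mul]
    rw [thetaArg_intCast, hq]
    simp [hι]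
  · by_cases hr : (n, l) ∈ Set.range ι
    · obtain ⟨m, hm⟩ := hr
      simp only [hι, Prod.mk.injEq] at hm
      obtain ⟨rfl, rfl⟩ := hm
      simp only [bil_intCast, hq]
      push_cast
      ring
    · simp [hr] at h

lemma isSingularJacobiForm_theta (hpos : (S₀.map (Int.cast : ℤ → ℝ)).PosDef) (hu : IsUnit S₀)
    (hk : s = 2 * k) (heven : ∀ n : Fin s → ℤ, ∃ a : ℤ, bil S₀ n n = 2 * a) :
    IsSingularJacobiForm S₀ k 1 (theta S₀) := by
  obtain ⟨c, hc, hsing⟩ := exists_hasFourier_theta hpos heven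
  refine ⟨⟨differentiableOn_theta hpos, fun γ hγ Z hZ => ?_, c, hc, fun n l h =>
    (hsing n l h).ge⟩, c, hc, hsing⟩
  obtain ⟨hcone, h⟩ := ΓJ_le_stabilizer hpos hu hk heven hγ
  exact (slash_eq_iff S₀ k _ _ Z (hcone.actBorel_eq hZ).1).2 (h Z hZ)

/-- Moving from (i, 0) to (i, ie₁), with e₁ the first basis vector, multiplies the nonzero value
there by exp(πS₀[e₁]) > 1. -/
lemma theta_not_constant (hs : 0 < s) (hpos : (S₀.map (Int.cast : ℤ → ℝ)).PosDef) :
    ¬ ∃ a : ℂ, ∀ p ∈ dom s, theta S₀ p = a := by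
  rintro ⟨a, ha⟩
  have hS := transpose_eq_of_posDef hpos
  have h := theta_add_int hS (Pi.single ⟨0, hs⟩ 1) 0 Complex.I 0
  have hI : ∀ z : Fin s → ℂ, (Complex.I, z) ∈ dom s := fun z => by simp [dom]
  have h0 := theta_I_ne_zero hpos
  rw [ha _ (hI _), ← ha _ (hI 0), eq_comm, mul_eq_right₀ h0, bil_zero_right,
    bil_single_single] at h
  have hd : (0 : ℝ) < S₀ ⟨0, hs⟩ ⟨0, hs⟩ := by
    simpa using hpos.diag_pos (i := ⟨0, hs⟩)
  have harg : -(2 * Real.pi * Complex.I * (0 + ((S₀ ⟨0, hs⟩ ⟨0, hs⟩ : ℤ) : ℂ) / 2 * Complex.I)) =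
      ((Real.pi * (S₀ ⟨0, hs⟩ ⟨0, hs⟩ : ℤ) : ℝ) : ℂ) := by
    push_cast
    linear_combination (-Real.pi * ((S₀ ⟨0, hs⟩ ⟨0, hs⟩ : ℤ) : ℂ)) * Complex.I_mul_I
  simp only [Int.cast_id] at h
  rw [harg, ← Complex.ofReal_exp, Complex.ofReal_eq_one, Real.exp_eq_one_iff] at h
  have := mul_pos Real.pi_pos hd
  exact this.ne' h

end theta

end OrthJacobi

end

theorem proposition4p12 (s : ℕ) (hs : 0 < s) (S₀ : Matrix (Fin s) (Fin s) ℤ)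
    (hpos : (S₀.map (Int.cast : ℤ → ℝ)).PosDef) (heven : ∀ i, Even (S₀ i i))
    (hmax : OrthJacobi.IsMaximalEven (OrthJacobi.gramM S₀)) :
    (∃ (k : ℕ) (φ : ℂ × (Fin s → ℂ) → ℂ), OrthJacobi.IsSingularJacobiForm S₀ k 1 φ ∧
        ¬ ∃ a : ℂ, ∀ p ∈ OrthJacobi.dom s, φ p = a) ↔
      OrthJacobi.IsUnimodular (OrthJacobi.gramM S₀) := by
  constructor
  · rintro ⟨k, φ, hφ, hne⟩
    have hex : ∃ p ∈ OrthJacobi.dom s, φ p ≠ 0 := by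
      by_contra! h
      exact hne ⟨0, h⟩
    obtain ⟨p, hp, hp0⟩ := hex
    exact OrthJacobi.isUnimodular_of_dual hpos fun μ hμ ν hν =>
      hφ.exists_int_bil hpos hmax hp hp0 hμ hν
  · intro hM
    have hu := OrthJacobi.isUnit_of_isUnimodular_gramM hM
    obtain ⟨k, hk⟩ := OrthJacobi.even_of_isUnit (OrthJacobi.transpose_eq_of_posDef hpos) heven hu
    exact ⟨k, OrthJacobi.theta S₀,
      OrthJacobi.isSingularJacobiForm_theta hpos hu (by omega) (OrthJacobi.even_bil_self hmax),
      OrthJacobi.theta_not_constant hs hpos⟩
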